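/- A graphon is a symmetric Lebesgue measurable function $\kappa:[0,1]^2\to[0,1]$. Let $F$ be a simple graph on $k\ge 1$ vertices and let $n\ge k$. Let $X_i$ ($1\le i\le n$) and $Y_{i,j}$ ($1\le i<j\le n$) be jointly independent random variables, uniformly distributed on $[0,1]$. The $\kappa$-random graph $\mathbb G(n,\kappa)$ is the graph on $\{1,\dots,n\}$ with edge indicators $\xi_{i,j}=\mathbf 1\{Y_{i,j}\le\kappa(X_i,X_j)\}$, $i<j$. Put $$\phi_F^{\mathrm{inj}}\bigl((x_{i,j})_{1\le i<j\le k}\bigr)=\sum_{H\cong F}\ \prod_{(i,j)\in E(H)}x_{i,j},\qquad \phi_F^{\mathrm{ind}}\bigl((x_{i,j})_{1\le i<j\le k}\bigr)=\sum_{H\cong F}\ \prod_{(i,j)\in E(H)}x_{i,j}\prod_{(i,j)\notin E(H)}(1-x_{i,j}),$$ where $H$ ranges over the graphs with vertex set $\{1,\dots,k\}$ that are isomorphic to $F$, and the products are over pairs $i<j$. For $\ast\in\{\mathrm{inj},\mathrm{ind}\}$ let $$T_F^{\ast}=\sum_{1\le\alpha(1)<\dots<\alpha(k)\le n}\phi_F^{\ast}\bigl((\xi_{\alpha(i),\alpha(j)})_{1\le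 i<j\le k}\bigr),\qquad f_1^{\ast}(x)=\mathbb E\bigl\{\phi_F^{\ast}\bigl((\xi_{i,j})_{1\le i<j\le k}\bigr)\bigm|X_1=x\bigr\},$$ $$\sigma_1^{\ast}=\bigl\|f_1^{\ast}(X_1)-\mathbb E\{f_1^{\ast}(X_1)\}\bigr\|_2=\Bigl(\mathbb E\bigl(f_1^{\ast}(X_1)-\mathbb E f_1^{\ast}(X_1)\bigr)^2\Bigr)^{1/2}.$$ Let $\Phi$ be the distribution function of $N(0,1)$. **Theorem 3.1.** If $\sigma_1^{\mathrm{inj}}>0$, then for all $n\ge k$ $$\sup_{z\in\mathbb R}\left|\mathbb P\left[\frac{\sqrt n}{k\,\sigma_1^{\mathrm{inj}}}\binom nk^{-1}\bigl(T_F^{\mathrm{inj}}-\mathbb E\{T_F^{\mathrm{inj}}\}\bigr)\le z\right]-\Phi(z)\right|\le C\,n^{-1/2}.$$ Moreover, if $\sigma_1^{\mathrm{ind}}>0$, then for all $n\ge k$ $$\sup_{z\in\mathbb R}\left|\mathbb P\left[\frac{\sqrt n}{k\,\sigma_1^{\mathrm{ind}}}\binom nk^{-1}\bigl(T_F^{\mathrm{ind}}-\mathbb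 E\{T_F^{\mathrm{ind}}\}\bigr)\le z\right]-\Phi(z)\right|\le C\,n^{-1/2}.$$ In the first bound $C$ depends only on $F$ and $\sigma_1^{\mathrm{inj}}$, and in the second only on $F$ and $\sigma_1^{\mathrm{ind}}$; in particular, neither depends on $n$. -/

import Mathlib

open MeasureTheory ProbabilityTheory

namespace KappaGraph

/-- A graphon: a symmetric Lebesgue measurable function from the unit square to the unit interval.
Lebesgue measurability is measurability with respect to the completion of the Borel σ-algebra
under Lebesgue measure, that is, `NullMeasurable`. -/
structure Graphon where
  toFun : unitInterval → unitInterval → unitInterval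
  symm : ∀ x y, toFun x y = toFun y x
  nullMeasurable :
    NullMeasurable (fun q : unitInterval × unitInterval => toFun q.1 q.2) volume

/-- The index set of pairs `(i, j)` with `1 ≤ i < j ≤ n`. -/
abbrev Pairs (n : ℕ) : Type := {p : Fin n × Fin n // p.1 < p.2}

/-- The pair `(α(i), α(j))` for an increasing index `α` and a pair `i < j`. -/
def mapPair {k n : ℕ} (α : Fin k ↪o Fin n) (p : Pairs k) : Pairs n :=
  ⟨(α p.1.1, α p.1.2), α.strictMono p.2⟩

open Classical in
/-- The polynomial `∑_{H ≅ F} ∏_{(i,j) ∈ E(H)} x_{i,j}`, where `H` ranges over the graphs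
on the vertex set of size `k` that are isomorphic to `F`. -/
noncomputable def phiInj {k : ℕ} (F : SimpleGraph (Fin k)) (x : Pairs k → ℝ) : ℝ :=
  ∑ H : SimpleGraph (Fin k) with Nonempty (H ≃g F),
    ∏ p : Pairs k with H.Adj p.1.1 p.1.2, x p

open Classical in
/-- The polynomial `∑_{H ≅ F} ∏_{(i,j) ∈ E(H)} x_{i,j} ∏_{(i,j) ∉ E(H)} (1 - x_{i,j})`. -/
noncomputable def phiInd {k : ℕ} (F : SimpleGraph (Fin k)) (x : Pairs k → ℝ) : ℝ :=
  ∑ H : SimpleGraph (Fin k) with Nonempty (H ≃g F),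
    (∏ p : Pairs k with H.Adj p.1.1 p.1.2, x p) *
      ∏ p : Pairs k with ¬ H.Adj p.1.1 p.1.2, (1 - x p)

open Classical in
/-- The edge indicators `ξ_{i,j} = 1{y_{i,j} ≤ κ(x_i, x_j)}`, `i < j`. -/
noncomputable def edgeInd {n : ℕ} (κ : Graphon) (x : Fin n → unitInterval)
    (y : Pairs n → unitInterval) : Pairs n → ℝ :=
  fun p => if y p ≤ κ.toFun (x p.1.1) (x p.1.2) then 1 else 0

open Classical in
/-- The injective count of `F` in the graph on `n` vertices with edge indicators `ξ`:
the sum over all `α(1) < ⋯ < α(k)` of `phiInj F` at the indicators `ξ_{α(i),α(j)}`. -/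
noncomputable def countInj {k n : ℕ} (F : SimpleGraph (Fin k)) (ξ : Pairs n → ℝ) : ℝ :=
  ∑ α : Fin k ↪o Fin n, phiInj F (fun p => ξ (mapPair α p))

open Classical in
/-- The induced count of `F` in the graph on `n` vertices with edge indicators `ξ`. -/
noncomputable def countInd {k n : ℕ} (F : SimpleGraph (Fin k)) (ξ : Pairs n → ℝ) : ℝ :=
  ∑ α : Fin k ↪o Fin n, phiInd F (fun p => ξ (mapPair α p))

/-- `E{ g(X_1, …, X_k; Y_{1,2}, …, Y_{k-1,k}) | X_1 = t }` for independent uniform variables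
`X_i`, `Y_{i,j}`: the first `x`-coordinate is frozen at `t`, all others are integrated out. -/
noncomputable def condFirst {k : ℕ} [NeZero k]
    (g : (Fin k → unitInterval) → (Pairs k → unitInterval) → ℝ) (t : unitInterval) : ℝ :=
  ∫ x : Fin k → unitInterval, ∫ y : Pairs k → unitInterval, g (Function.update x 0 t) y

/-- `f_1^inj(t) = E{ f_F^inj(X; Y) | X_1 = t }`. -/
noncomputable def projInj {k : ℕ} [NeZero k] (κ : Graphon) (F : SimpleGraph (Fin k)) :
    unitInterval → ℝ :=
  condFirst fun x y => phiInj F (edgeInd κ x y)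

/-- `f_1^ind(t) = E{ f_F^ind(X; Y) | X_1 = t }`. -/
noncomputable def projInd {k : ℕ} [NeZero k] (κ : Graphon) (F : SimpleGraph (Fin k)) :
    unitInterval → ℝ :=
  condFirst fun x y => phiInd F (edgeInd κ x y)

/-- The `L²` norm `‖h(X_1) - E h(X_1)‖₂`, with `X_1` uniform on `[0,1]`. -/
noncomputable def centeredL2 (h : unitInterval → ℝ) : ℝ :=
  Real.sqrt (∫ t, (h t - ∫ s, h s) ^ 2)

/-- `σ_1^inj`. -/
noncomputable def sigmaInj {k : ℕ} [NeZero k] (κ : Graphon) (F : SimpleGraph (Fin k)) : ℝ :=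
  centeredL2 (projInj κ F)

/-- `σ_1^ind`. -/
noncomputable def sigmaInd {k : ℕ} [NeZero k] (κ : Graphon) (F : SimpleGraph (Fin k)) : ℝ :=
  centeredL2 (projInd κ F)

/-- The variables `X_i` (`1 ≤ i ≤ n`) and `Y_{i,j}` (`1 ≤ i < j ≤ n`) are jointly independent
and uniformly distributed on `[0,1]`. The random graph on `n` vertices with edge
indicators `edgeInd κ X Y` is then the `κ`-random graph. -/
structure IsUniformSample {Ω : Type*} [MeasurableSpace Ω] (μ : Measure Ω) {n : ℕ}
    (X : Fin n → Ω → unitInterval) (Y : Pairs n → Ω → unitInterval) : Prop where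
  lawX : ∀ i, HasLaw (X i) volume μ
  lawY : ∀ p, HasLaw (Y p) volume μ
  indep : iIndepFun (β := fun _ : Fin n ⊕ Pairs n => unitInterval) (Sum.elim X Y) μ

/-- The injective count `T_F^inj` of `F` in the `κ`-random graph built from `X` and `Y`. -/
noncomputable def TInj {Ω : Type*} {k n : ℕ} (κ : Graphon) (F : SimpleGraph (Fin k))
    (X : Fin n → Ω → unitInterval) (Y : Pairs n → Ω → unitInterval) (ω : Ω) : ℝ :=
  countInj F (edgeInd κ (fun i => X i ω) (fun p => Y p ω))

/-- The induced count `T_F^ind` of `F` in the `κ`-random graph built from `X` and `Y`. -/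
noncomputable def TInd {Ω : Type*} {k n : ℕ} (κ : Graphon) (F : SimpleGraph (Fin k))
    (X : Fin n → Ω → unitInterval) (Y : Pairs n → Ω → unitInterval) (ω : Ω) : ℝ :=
  countInd F (edgeInd κ (fun i => X i ω) (fun p => Y p ω))

/-- The Kolmogorov distance `sup_z |P[W ≤ z] - Φ(z)|` between a real random variable `W` and the
standard normal distribution. -/
noncomputable def kolmogorovDist {Ω : Type*} [MeasurableSpace Ω] (μ : Measure Ω)
    (W : Ω → ℝ) : ℝ :=
  ⨆ z : ℝ, |μ.real {ω | W ω ≤ z} - (gaussianReal 0 1).real (Set.Iic z)|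

end KappaGraph

open KappaGraph

/-! The count is a U-statistic: a sum over increasing `α` of one bounded kernel of the independent
uniform variables attached to the vertices and pairs of `α`. Summing over all `H ≅ F` makes the
kernel invariant under relabelling of vertices, so its conditional expectation given `X_j` is the
same function for every `j`. Subtracting the mean and these centred projections leaves `rem`, and
the normalised count becomes `W + D`. Here `W` is a sum of `n` i.i.d. centred terms of size
`O(n^{-1/2})` with total variance one, and `D` is the normalised sum of the remainders
(`SymmKernel.ustat_sub_eq`).

Two remainders are orthogonal unless their index sets share two vertices: otherwise they have at
most one variable in common, some `X_i`, and `rem` has mean zero given it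
(`SymmKernel.integral_rem_mul_rem`). Counting the overlapping pairs gives `‖D‖₂ = O(n^{-1/2})`, and
deleting the terms that contain a vertex `i` changes `D` by `O(n^{-1})` in `L²`.

Stein's method gives a Berry–Esseen bound for `W` (`StdSummands.berryEsseen`). Passing to `W + D`
costs `P(|W - z| ≤ |D|)`. This is controlled by `StdSummands.concentration` even though `D` depends
on `W`, by means of leave-one-out copies `D' i` such that `ξ i` is independent of the pair `(W - ξ
i, D' i)`.

The constant depends on `k` and `σ` only, because the kernel is bounded by the number of graphs on
`k` vertices. A Lebesgue measurable graphon is replaced by a Borel one, which alters the count only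
on a null event. -/

namespace KappaGraph

/-! ### Normal distribution function, density and tail bounds. -/

/-- The distribution function of the standard normal distribution. -/
noncomputable def stdCdf (x : ℝ) : ℝ := (gaussianReal 0 1).real (Set.Iic x)

/-- The standard normal density. -/
noncomputable def stdPdf (x : ℝ) : ℝ := gaussianPDFReal 0 1 x

lemma stdPdf_eq (x : ℝ) : stdPdf x = (√(2 * Real.pi))⁻¹ * Real.exp (-x ^ 2 / 2) := by
  simp [stdPdf, gaussianPDFReal]

lemma stdPdf_pos (x : ℝ) : 0 < stdPdf x := gaussianPDFReal_pos 0 1 x one_ne_zero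

lemma hasDerivAt_stdPdf (x : ℝ) : HasDerivAt stdPdf (-(x * stdPdf x)) x := by
  have h : HasDerivAt (fun x : ℝ => (√(2 * Real.pi))⁻¹ * Real.exp (-x ^ 2 / 2))
      ((√(2 * Real.pi))⁻¹ * (Real.exp (-x ^ 2 / 2) * (-(2 * x) / 2))) x := by
    have := (((hasDerivAt_pow 2 x).neg.div_const 2).exp).const_mul ((√(2 * Real.pi))⁻¹)
    simpa using this
  rw [show stdPdf = _ from funext stdPdf_eq]
  convert h using 1
  ring

lemma continuous_stdPdf : Continuous stdPdf :=
  continuous_iff_continuousAt.2 fun x => (hasDerivAt_stdPdf x).continuousAt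

lemma integrable_stdPdf : Integrable stdPdf := integrable_gaussianPDFReal 0 1

lemma stdCdf_eq_integral (x : ℝ) : stdCdf x = ∫ t in Set.Iic x, stdPdf t := by
  rw [stdCdf, Measure.real, gaussianReal_apply_eq_integral 0 one_ne_zero, ENNReal.toReal_ofReal]
  · rfl
  · exact integral_nonneg fun t => (stdPdf_pos t).le

lemma hasDerivAt_stdCdf (x : ℝ) : HasDerivAt stdCdf (stdPdf x) x := by
  have h : stdCdf = fun y => (∫ t in Set.Iic 0, stdPdf t) + ∫ t in (0 : ℝ)..y, stdPdf t := by
    funext y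
    rw [stdCdf_eq_integral, ← intervalIntegral.integral_Iic_sub_Iic
      integrable_stdPdf.integrableOn integrable_stdPdf.integrableOn]
    ring
  rw [h]
  exact (continuous_stdPdf.integral_hasStrictDerivAt 0 x).hasDerivAt.const_add _

lemma stdCdf_nonneg (x : ℝ) : 0 ≤ stdCdf x := measureReal_nonneg

lemma stdCdf_le_one (x : ℝ) : stdCdf x ≤ 1 := measureReal_le_one

lemma stdCdf_mono : Monotone stdCdf := fun _ _ h => measureReal_mono (Set.Iic_subset_Iic.2 h)

lemma stdCdf_neg (x : ℝ) : stdCdf (-x) = 1 - stdCdf x := by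
  have h1 : (gaussianReal 0 1).map (fun y => -y) = gaussianReal 0 1 := by
    simpa using gaussianReal_map_neg (μ := 0) (v := 1)
  have : NullSingletonClass (gaussianReal 0 1) := nullSingletonClass_gaussianReal one_ne_zero
  have h2 : stdCdf (-x) = (gaussianReal 0 1).real (Set.Ici x) := by
    rw [stdCdf]
    conv_lhs => rw [← h1]
    rw [map_measureReal_apply measurable_neg measurableSet_Iic]
    congr 1
    ext y
    simp
  rw [h2, stdCdf, ← probReal_compl_eq_one_sub measurableSet_Iic, Set.compl_Iic]
  exact measureReal_congr Ioi_ae_eq_Ici.symm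

/-- A Mills ratio bound for the normal tail. -/
lemma mul_one_sub_stdCdf_le (x : ℝ) : x * (1 - stdCdf x) ≤ stdPdf x := by
  rcases le_or_gt x 0 with hx | hx
  · exact (mul_nonpos_of_nonpos_of_nonneg hx (by linarith [stdCdf_le_one x])).trans (stdPdf_pos x).le
  -- The derivative is `-(1 - stdCdf y)`, because the two terms `y * stdPdf y` cancel. A decreasing
  -- function is nonnegative once it is bounded below by something tending to zero at infinity;
  -- Chebyshev's inequality supplies `-1 / y`.
  have hanti : Antitone fun y => stdPdf y - y * (1 - stdCdf y) := by
    refine antitone_of_hasDerivAt_nonpos (f' := fun y => -(1 - stdCdf y)) (fun y => ?_) fun y => ?_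
    · have := (hasDerivAt_stdPdf y).sub ((hasDerivAt_id y).mul ((hasDerivAt_stdCdf y).const_sub 1))
      refine this.congr_deriv ?_
      simp only [id]
      ring
    · simpa using stdCdf_le_one y
  have hcheb : ∀ y : ℝ, 0 < y → y * (1 - stdCdf y) ≤ 1 / y := by
    intro y hy
    have h := meas_ge_le_variance_div_sq (μ := gaussianReal 0 1) (X := id)
      (memLp_id_gaussianReal 2) hy
    rw [variance_id_gaussianReal] at h
    have h0 : ∫ x, id x ∂(gaussianReal 0 1) = 0 := integral_id_gaussianReal
    rw [h0] at h
    simp only [id, sub_zero] at h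
    have h' : 1 - stdCdf y ≤ 1 / y ^ 2 := by
      rw [stdCdf, ← probReal_compl_eq_one_sub measurableSet_Iic, Set.compl_Iic]
      refine (measureReal_mono (s₂ := {c : ℝ | y ≤ |c|}) ?_).trans ?_
      · intro c hc
        exact (le_of_lt hc).trans (le_abs_self c)
      · refine ENNReal.toReal_le_of_le_ofReal (by positivity) ?_
        simpa using h
    calc y * (1 - stdCdf y) ≤ y * (1 / y ^ 2) := by gcongr
      _ = 1 / y := by field_simp
  have hlim : Filter.Tendsto (fun y : ℝ => -(1 / y)) Filter.atTop (nhds 0) := by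
    simpa using (tendsto_inv_atTop_zero (𝕜 := ℝ)).neg
  have : 0 ≤ stdPdf x - x * (1 - stdCdf x) := by
    refine le_of_tendsto hlim ?_
    filter_upwards [Filter.eventually_ge_atTop x] with y hy
    have h1 := hanti hy
    have h2 := hcheb y (hx.trans_le hy)
    have h3 := stdPdf_pos y
    simp only at h1
    linarith
  linarith

/-- For `x ≥ 1` the Mills bound suffices. On `[0, 1)` the density is at least `1/6`, since the
exponential is at least `1/2` and `√(2π) ≤ 3`; this is the origin of the constant. -/
lemma one_sub_stdCdf_le {x : ℝ} (hx : 0 ≤ x) : 1 - stdCdf x ≤ 6 * stdPdf x := by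
  have hp := stdPdf_pos x
  rcases le_or_gt 1 x with h1 | h1
  · have := mul_one_sub_stdCdf_le x
    nlinarith [stdCdf_le_one x]
  · have h2 : (1 : ℝ) ≤ 6 * stdPdf x := by
      rw [stdPdf_eq]
      have e1 : 1 - 1 / 2 ≤ Real.exp (-x ^ 2 / 2) := by
        have := Real.add_one_le_exp (-x ^ 2 / 2)
        nlinarith
      have s1 : √(2 * Real.pi) ≤ 3 := by
        rw [Real.sqrt_le_left (by norm_num)]
        nlinarith [Real.pi_lt_d2]
      have s0 : 0 < √(2 * Real.pi) := by positivity
      have : (3 : ℝ)⁻¹ ≤ (√(2 * Real.pi))⁻¹ := by gcongr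
      nlinarith
    linarith [stdCdf_nonneg x]

lemma stdCdf_mul_one_sub_le (x : ℝ) : stdCdf x * (1 - stdCdf x) ≤ 6 * stdPdf x := by
  have key : ∀ y : ℝ, 0 ≤ y → stdCdf y * (1 - stdCdf y) ≤ 6 * stdPdf y := fun y hy => by
    have := one_sub_stdCdf_le hy
    nlinarith [stdCdf_le_one y, stdCdf_nonneg y]
  rcases le_total 0 x with hx | hx
  · exact key x hx
  · have := key (-x) (by linarith)
    rw [stdCdf_neg, stdPdf_eq, neg_sq, ← stdPdf_eq] at this
    linarith

lemma abs_mul_stdCdf_mul_one_sub_le (x : ℝ) : |x| * (stdCdf x * (1 - stdCdf x)) ≤ stdPdf x := by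
  have key : ∀ y : ℝ, 0 ≤ y → |y| * (stdCdf y * (1 - stdCdf y)) ≤ stdPdf y := fun y hy => by
    have := mul_one_sub_stdCdf_le y
    have h1 := stdCdf_le_one y
    have h2 := mul_nonneg hy (sub_nonneg.2 h1)
    rw [abs_of_nonneg hy]
    nlinarith [stdCdf_nonneg y]
  rcases le_total 0 x with hx | hx
  · exact key x hx
  · have := key (-x) (by linarith)
    rw [stdCdf_neg, stdPdf_eq, neg_sq, ← stdPdf_eq, abs_neg] at this
    linarith

/-! ### Stein's equation for half-line indicators. -/

/-- The bounded solution of Stein's equation for the indicator of `(-∞, z]`. -/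
noncomputable def steinSol (z w : ℝ) : ℝ :=
  stdCdf (min w z) * (1 - stdCdf (max w z)) / stdPdf w

/-- The right derivative of `steinSol`. -/
noncomputable def steinDeriv (z w : ℝ) : ℝ :=
  w * steinSol z w + (if w < z then 1 else 0) - stdCdf z

lemma continuous_stdCdf : Continuous stdCdf :=
  continuous_iff_continuousAt.2 fun x => (hasDerivAt_stdCdf x).continuousAt

lemma continuous_steinSol (z : ℝ) : Continuous (steinSol z) := by
  unfold steinSol
  have := continuous_stdCdf
  have := continuous_stdPdf
  exact Continuous.div (by fun_prop) (by fun_prop) fun x => (stdPdf_pos x).ne'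

lemma steinSol_nonneg (z w : ℝ) : 0 ≤ steinSol z w :=
  div_nonneg (mul_nonneg (stdCdf_nonneg _) (sub_nonneg.2 (stdCdf_le_one _))) (stdPdf_pos w).le

lemma steinSol_le (z w : ℝ) : steinSol z w ≤ stdCdf w * (1 - stdCdf w) / stdPdf w := by
  unfold steinSol
  refine div_le_div_of_nonneg_right ?_ (stdPdf_pos w).le
  refine mul_le_mul (stdCdf_mono (min_le_left _ _)) ?_ ?_ (stdCdf_nonneg w)
  · exact sub_le_sub_left (stdCdf_mono (le_max_left _ _)) 1
  · exact sub_nonneg.2 (stdCdf_le_one _)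

lemma abs_steinSol_le (z w : ℝ) : |steinSol z w| ≤ 6 := by
  rw [abs_of_nonneg (steinSol_nonneg z w)]
  refine (steinSol_le z w).trans ?_
  rw [div_le_iff₀ (stdPdf_pos w)]
  exact stdCdf_mul_one_sub_le w

lemma abs_mul_steinSol_le (z w : ℝ) : |w * steinSol z w| ≤ 1 := by
  rw [abs_mul, abs_of_nonneg (steinSol_nonneg z w)]
  refine (mul_le_mul_of_nonneg_left (steinSol_le z w) (abs_nonneg w)).trans ?_
  rw [← mul_div_assoc, div_le_iff₀ (stdPdf_pos w), one_mul]
  exact abs_mul_stdCdf_mul_one_sub_le w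

lemma abs_steinDeriv_le (z w : ℝ) : |steinDeriv z w| ≤ 2 := by
  have h := abs_le.1 (abs_mul_steinSol_le z w)
  have h0 := stdCdf_nonneg z
  have h1 := stdCdf_le_one z
  unfold steinDeriv
  split_ifs <;> rw [abs_le] <;> constructor <;> linarith

/-- The solution has a kink at `z`, so only the right derivative is available everywhere. Together
with continuity it is enough for the mean value inequality. -/
lemma hasDerivWithinAt_steinSol (z w : ℝ) :
    HasDerivWithinAt (steinSol z) (steinDeriv z w) (Set.Ici w) w := by
  have hp := (stdPdf_pos w).ne'
  rcases lt_or_ge w z with h | h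
  · have hd := ((hasDerivAt_stdCdf w).mul_const (1 - stdCdf z)).div (hasDerivAt_stdPdf w) hp
    have hd' : HasDerivAt (steinSol z) (steinDeriv z w) w := by
      refine (hd.congr_of_eventuallyEq (f₁ := steinSol z) ?_).congr_deriv ?_
      · filter_upwards [gt_mem_nhds h] with y hy
        simp [steinSol, min_eq_left hy.le, max_eq_right hy.le]
      · simp only [steinDeriv, steinSol, h, if_true, min_eq_left h.le, max_eq_right h.le]
        field_simp
        ring
    exact hd'.hasDerivWithinAt
  · have hd := (((hasDerivAt_stdCdf w).const_sub 1).const_mul (stdCdf z)).div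
      (hasDerivAt_stdPdf w) hp
    refine (hd.hasDerivWithinAt (s := Set.Ici w)).congr_of_mem (f₁ := steinSol z) ?_
      (Set.self_mem_Ici) |>.congr_deriv ?_
    · intro y hy
      have hy' : z ≤ y := h.trans hy
      simp [steinSol, min_eq_right hy', max_eq_left hy']
    · simp only [steinDeriv, steinSol, not_lt.2 h, if_false, min_eq_right h, max_eq_left h]
      field_simp
      ring

lemma abs_steinSol_sub_le (z a b : ℝ) : |steinSol z b - steinSol z a| ≤ 2 * |b - a| := by
  wlog hab : a ≤ b generalizing a b
  · rw [abs_sub_comm, abs_sub_comm b]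
    exact this b a (le_of_not_ge hab)
  have := norm_image_sub_le_of_norm_deriv_right_le_segment (f := steinSol z) (f' := steinDeriv z)
    (C := 2) (a := a) (b := b) (continuous_steinSol z).continuousOn
    (fun x _ => hasDerivWithinAt_steinSol z x) (fun x _ => abs_steinDeriv_le z x) b
    (Set.right_mem_Icc.2 hab)
  rwa [Real.norm_eq_abs, ← abs_of_nonneg (sub_nonneg.2 hab)] at this

open Classical in
/-- The left-continuous version of the derivative of `steinSol`. -/
noncomputable def steinDerivLeft (z w : ℝ) : ℝ :=
  w * steinSol z w + (if w ≤ z then 1 else 0) - stdCdf z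

lemma abs_steinDerivLeft_le (z w : ℝ) : |steinDerivLeft z w| ≤ 2 := by
  have h := abs_le.1 (abs_mul_steinSol_le z w)
  have h0 := stdCdf_nonneg z
  have h1 := stdCdf_le_one z
  unfold steinDerivLeft
  split_ifs <;> rw [abs_le] <;> constructor <;> linarith

-- The product `w * steinSol z w` is locally Lipschitz, and the jump of the derivative is felt only
-- when `z` separates `s` from `w`, which forces `w` to be within `δ` of `z`. The indicator is later
-- paid for by the concentration inequality.
open Classical in
lemma abs_steinDeriv_sub_le {z w s δ : ℝ} (h : |s - w| ≤ δ) :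
    |steinDeriv z s - steinDerivLeft z w| ≤
      (2 * |w| + 6) * δ + (if z - δ ≤ w ∧ w ≤ z + δ then 1 else 0) := by
  have h1 : |s * steinSol z s - w * steinSol z w| ≤ (2 * |w| + 6) * δ := by
    have e : s * steinSol z s - w * steinSol z w =
        w * (steinSol z s - steinSol z w) + (s - w) * steinSol z s := by ring
    rw [e]
    refine (abs_add_le _ _).trans ?_
    rw [abs_mul, abs_mul]
    have a1 := abs_steinSol_sub_le z w s
    have a2 := abs_steinSol_le z s
    have hδ : 0 ≤ δ := (abs_nonneg _).trans h
    calc |w| * |steinSol z s - steinSol z w| + |s - w| * |steinSol z s|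
        ≤ |w| * (2 * δ) + δ * 6 := by gcongr; linarith
      _ = _ := by ring
  have h2 : |(if s < z then (1 : ℝ) else 0) - (if w ≤ z then 1 else 0)| ≤
      if z - δ ≤ w ∧ w ≤ z + δ then 1 else 0 := by
    rw [abs_le] at h
    by_cases hw : z - δ ≤ w ∧ w ≤ z + δ
    · rw [if_pos hw]
      split_ifs <;> simp
    · rw [if_neg hw]
      rw [not_and_or, not_le, not_le] at hw
      rcases hw with hw | hw
      · rw [if_pos (by linarith), if_pos (by linarith)]; simp
      · rw [if_neg (by linarith), if_neg (by linarith)]; simp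
  have e : steinDeriv z s - steinDerivLeft z w = (s * steinSol z s - w * steinSol z w) +
      ((if s < z then (1 : ℝ) else 0) - (if w ≤ z then 1 else 0)) := by
    unfold steinDeriv steinDerivLeft; ring
  rw [e]
  exact (abs_add_le _ _).trans (add_le_add h1 h2)

-- This is the mean value inequality for `steinSol z x - x * D`, where `D` is the derivative frozen
-- at `w`, on the segment between `w - t` and `w`.
open Classical in
lemma abs_steinSol_taylor_le {z w t δ : ℝ} (h : |t| ≤ δ) :
    |steinSol z w - steinSol z (w - t) - t * steinDerivLeft z w| ≤
      |t| * ((2 * |w| + 6) * δ + (if z - δ ≤ w ∧ w ≤ z + δ then 1 else 0)) := by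
  set D := steinDerivLeft z w with hD
  have key : ∀ a b : ℝ, a ≤ b → (∀ x ∈ Set.Icc a b, |x - w| ≤ δ) →
      |(steinSol z b - b * D) - (steinSol z a - a * D)| ≤
      ((2 * |w| + 6) * δ + (if z - δ ≤ w ∧ w ≤ z + δ then 1 else 0)) * (b - a) := by
    intro a b hab hx
    refine norm_image_sub_le_of_norm_deriv_right_le_segment
      (f := fun x => steinSol z x - x * D) (f' := fun x => steinDeriv z x - D)
      (a := a) (b := b) ?_ (fun x _ => ?_) (fun x hx' => ?_) b (Set.right_mem_Icc.2 hab)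
    · have := continuous_steinSol z
      fun_prop
    · have h1 := (hasDerivWithinAt_id x (Set.Ici x)).mul_const D
      rw [one_mul] at h1
      exact (hasDerivWithinAt_steinSol z x).sub h1
    · exact abs_steinDeriv_sub_le (hx x ⟨hx'.1, hx'.2.le⟩)
  rcases le_total 0 t with ht | ht
  · have := key (w - t) w (by linarith) fun x hx => by
      rw [abs_le] at h ⊢; constructor <;> linarith [hx.1, hx.2]
    rw [abs_of_nonneg ht]
    convert this using 1
    · congr 1; ring
    · ring
  · have := key w (w - t) (by linarith) fun x hx => by
      rw [abs_le] at h ⊢; constructor <;> linarith [hx.1, hx.2]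
    rw [abs_of_nonpos ht]
    rw [abs_sub_comm] at this
    convert this using 1
    · congr 1; ring
    · ring

/-! ### Stein's method for bounded independent summands. -/

section SteinMethod

/-- Bounded measurable real functions. -/
structure BddMeas {Ω : Type*} [MeasurableSpace Ω] (f : Ω → ℝ) : Prop where
  meas : Measurable f
  bdd : ∃ C, ∀ ω, |f ω| ≤ C

namespace BddMeas

variable {Ω : Type*} [MeasurableSpace Ω] {f g : Ω → ℝ}

lemma const (c : ℝ) : BddMeas (fun _ : Ω => c) := ⟨measurable_const, |c|, fun _ => le_rfl⟩

lemma add (hf : BddMeas f) (hg : BddMeas g) : BddMeas (fun ω => f ω + g ω) := by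
  obtain ⟨C, hC⟩ := hf.bdd
  obtain ⟨D, hD⟩ := hg.bdd
  exact ⟨hf.meas.add hg.meas, C + D, fun ω => (abs_add_le _ _).trans (add_le_add (hC ω) (hD ω))⟩

lemma mul (hf : BddMeas f) (hg : BddMeas g) : BddMeas (fun ω => f ω * g ω) := by
  obtain ⟨C, hC⟩ := hf.bdd
  obtain ⟨D, hD⟩ := hg.bdd
  refine ⟨hf.meas.mul hg.meas, C * D, fun ω => ?_⟩
  rw [abs_mul]
  exact mul_le_mul (hC ω) (hD ω) (abs_nonneg _) ((abs_nonneg _).trans (hC ω))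

lemma neg (hf : BddMeas f) : BddMeas (fun ω => -f ω) := by
  simpa using (const (-1)).mul hf

lemma sub (hf : BddMeas f) (hg : BddMeas g) : BddMeas (fun ω => f ω - g ω) := by
  simpa [sub_eq_add_neg] using hf.add hg.neg

lemma abs (hf : BddMeas f) : BddMeas (fun ω => |f ω|) :=
  ⟨hf.meas.abs, hf.bdd.imp fun C hC ω => by simpa using hC ω⟩

lemma sq (hf : BddMeas f) : BddMeas (fun ω => f ω ^ 2) := by
  simpa [pow_two] using hf.mul hf

lemma sum {ι : Type*} {s : Finset ι} {F : ι → Ω → ℝ} (h : ∀ i ∈ s, BddMeas (F i)) :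
    BddMeas (fun ω => ∑ i ∈ s, F i ω) := by
  classical
  induction s using Finset.induction_on with
  | empty => simpa using const (0 : ℝ)
  | insert a s ha ih =>
    simp_rw [Finset.sum_insert ha]
    exact (h a (Finset.mem_insert_self a s)).add
      (ih fun i hi => h i (Finset.mem_insert_of_mem hi))

lemma comp {Ω' : Type*} [MeasurableSpace Ω'] (hf : BddMeas f) {e : Ω' → Ω} (he : Measurable e) :
    BddMeas (fun ω => f (e ω)) :=
  ⟨hf.meas.comp he, hf.bdd.imp fun _ hC ω => hC (e ω)⟩

lemma integrable (hf : BddMeas f) (μ : Measure Ω) [IsFiniteMeasure μ] : Integrable f μ := by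
  obtain ⟨C, hC⟩ := hf.bdd
  exact Integrable.of_bound hf.meas.aestronglyMeasurable C (ae_of_all _ hC)

lemma memLp (hf : BddMeas f) (μ : Measure Ω) [IsFiniteMeasure μ] (p : ENNReal) :
    MemLp f p μ := by
  obtain ⟨C, hC⟩ := hf.bdd
  exact MemLp.of_bound hf.meas.aestronglyMeasurable C (ae_of_all _ hC)

lemma indicator {s : Set Ω} (hs : MeasurableSet s) : BddMeas (s.indicator (1 : Ω → ℝ)) := by
  refine ⟨measurable_one.indicator hs, 1, fun ω => ?_⟩
  by_cases h : ω ∈ s <;> simp [h]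

/-- The Cauchy–Schwarz inequality. -/
lemma integral_abs_mul_abs_le (hf : BddMeas f) (hg : BddMeas g) (μ : Measure Ω)
    [IsFiniteMeasure μ] :
    ∫ ω, |f ω| * |g ω| ∂μ ≤ √(∫ ω, f ω ^ 2 ∂μ) * √(∫ ω, g ω ^ 2 ∂μ) := by
  have h := integral_mul_le_Lp_mul_Lq_of_nonneg (μ := μ) Real.HolderConjugate.two_two
    (f := fun ω => |f ω|) (g := fun ω => |g ω|) (ae_of_all _ fun _ => abs_nonneg _)
    (ae_of_all _ fun _ => abs_nonneg _) (hf.abs.memLp μ _) (hg.abs.memLp μ _)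
  simpa [Real.sqrt_eq_rpow] using h

lemma integral_abs_le (hf : BddMeas f) (μ : Measure Ω) [IsProbabilityMeasure μ] :
    ∫ ω, |f ω| ∂μ ≤ √(∫ ω, f ω ^ 2 ∂μ) := by
  simpa using hf.integral_abs_mul_abs_le (const 1) μ

end BddMeas

variable {Ω : Type*} [MeasurableSpace Ω] {μ : Measure Ω}

/-- Independent centred random variables bounded by `δ` whose variances sum to one. -/
structure StdSummands {ι : Type*} [Fintype ι] (μ : Measure Ω) (ξ : ι → Ω → ℝ) (δ : ℝ) :
    Prop where
  meas : ∀ i, Measurable (ξ i)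
  bound : ∀ i ω, |ξ i ω| ≤ δ
  mean : ∀ i, ∫ ω, ξ i ω ∂μ = 0
  var : ∑ i, ∫ ω, ξ i ω ^ 2 ∂μ = 1
  -- Pairwise independence serves the second-moment bounds; independence of one summand from the
  -- rest is a separate hypothesis of the theorems below.
  indep : Pairwise fun i j => IndepFun (ξ i) (ξ j) μ

namespace StdSummands

variable {ι : Type*} [Fintype ι] {ξ : ι → Ω → ℝ} {δ : ℝ}

lemma bddMeas (h : StdSummands μ ξ δ) (i : ι) : BddMeas (ξ i) := ⟨h.meas i, δ, h.bound i⟩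

lemma bddMeas_sum (h : StdSummands μ ξ δ) : BddMeas (fun ω => ∑ i, ξ i ω) :=
  BddMeas.sum fun i _ => h.bddMeas i

lemma bddMeas_sq (h : StdSummands μ ξ δ) : BddMeas (fun ω => ∑ i, ξ i ω ^ 2 - 1) :=
  (BddMeas.sum fun i _ => (h.bddMeas i).sq).sub (.const 1)

lemma integral_mul_eq_zero (h : StdSummands μ ξ δ) {E : Type*} [MeasurableSpace E] {i : ι}
    {Y : Ω → E} (hind : IndepFun (ξ i) Y μ) (hY : Measurable Y) {φ : E → ℝ} (hφ : Measurable φ) :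
    ∫ ω, ξ i ω * φ (Y ω) ∂μ = 0 := by
  have := (hind.comp (φ := id) (ψ := φ) measurable_id hφ).integral_fun_mul_eq_mul_integral
    (h.meas i).aestronglyMeasurable (hφ.comp hY).aestronglyMeasurable
  simpa [h.mean] using this

end StdSummands

variable [IsProbabilityMeasure μ]

lemma integral_sq_sum_sub_le {ι : Type*} [Fintype ι] {X : ι → Ω → ℝ} (hX : ∀ i, BddMeas (X i))
    (hind : Pairwise fun i j => IndepFun (X i) (X j) μ) :
    ∫ ω, (∑ i, X i ω - ∑ i, ∫ ω', X i ω' ∂μ) ^ 2 ∂μ ≤ ∑ i, ∫ ω, X i ω ^ 2 ∂μ := by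
  have h := IndepFun.variance_sum (μ := μ) (X := X) (s := Finset.univ)
    (fun i _ => (hX i).memLp μ 2) (fun i _ j _ hij => hind hij)
  have e : ∫ ω, (∑ i, X i) ω ∂μ = ∑ i, ∫ ω', X i ω' ∂μ := by
    simp_rw [Finset.sum_apply]
    exact integral_finsetSum _ fun i _ => (hX i).integrable μ
  have hm : Measurable (∑ i, X i) := by
    rw [show ∑ i, X i = fun ω => ∑ i, X i ω from by ext; simp]
    exact Finset.measurable_sum _ fun i _ => (hX i).meas
  rw [variance_eq_integral hm.aemeasurable, e] at h
  simp_rw [Finset.sum_apply] at h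
  rw [h]
  refine Finset.sum_le_sum fun i _ => ?_
  have := variance_le_expectation_sq (μ := μ) (X := X i) (hX i).meas.aestronglyMeasurable
  simpa using this

namespace StdSummands

variable {ι : Type*} [Fintype ι] {ξ : ι → Ω → ℝ} {δ : ℝ}

lemma nonneg (h : StdSummands μ ξ δ) : 0 ≤ δ := by
  have : Nonempty ι := by
    by_contra hι
    rw [not_nonempty_iff] at hι
    simpa using h.var
  obtain ⟨ω⟩ : Nonempty Ω := nonempty_of_isProbabilityMeasure μ
  exact (abs_nonneg _).trans (h.bound (Classical.arbitrary ι) ω)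

lemma integral_sq_sum_le (h : StdSummands μ ξ δ) : ∫ ω, (∑ i, ξ i ω) ^ 2 ∂μ ≤ 1 := by
  have := integral_sq_sum_sub_le (μ := μ) h.bddMeas h.indep
  simpa [h.mean, h.var] using this

lemma integral_abs_sum_le (h : StdSummands μ ξ δ) : ∫ ω, |∑ i, ξ i ω| ∂μ ≤ 1 :=
  (h.bddMeas_sum.integral_abs_le μ).trans (Real.sqrt_le_one.2 h.integral_sq_sum_le)

/-- The squares are pairwise independent, so the left side squared is at most the sum of fourth
moments. Each is at most `δ ^ 2` times a second moment, and those sum to one. -/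
lemma sqrt_integral_sq_sub_one_le (h : StdSummands μ ξ δ) :
    √(∫ ω, (∑ i, ξ i ω ^ 2 - 1) ^ 2 ∂μ) ≤ δ := by
  rw [Real.sqrt_le_left h.nonneg]
  have h1 := integral_sq_sum_sub_le (μ := μ) (X := fun i ω => ξ i ω ^ 2)
    (fun i => (h.bddMeas i).sq) fun i j hij =>
      (h.indep hij).comp (φ := fun x => x ^ 2) (ψ := fun x => x ^ 2)
        (measurable_id.pow_const 2) (measurable_id.pow_const 2)
  rw [h.var] at h1
  refine h1.trans ?_
  calc ∑ i, ∫ ω, (ξ i ω ^ 2) ^ 2 ∂μ ≤ ∑ i, δ ^ 2 * ∫ ω, ξ i ω ^ 2 ∂μ := by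
        refine Finset.sum_le_sum fun i _ => ?_
        rw [← integral_const_mul]
        refine integral_mono ((h.bddMeas i).sq.sq.integrable μ)
          (((BddMeas.const _).mul (h.bddMeas i).sq).integrable μ) fun ω => ?_
        have : ξ i ω ^ 2 ≤ δ ^ 2 := sq_le_sq.2 ((h.bound i ω).trans (le_abs_self δ))
        simp only
        nlinarith [sq_nonneg (ξ i ω)]
    _ = δ ^ 2 := by rw [← Finset.mul_sum, h.var, mul_one]

lemma integral_abs_sq_sub_one_le (h : StdSummands μ ξ δ) :
    ∫ ω, |∑ i, ξ i ω ^ 2 - 1| ∂μ ≤ δ :=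
  (h.bddMeas_sq.integral_abs_le μ).trans h.sqrt_integral_sq_sub_one_le

end StdSummands

/-! ### Randomized concentration and Berry–Esseen bounds. -/

/-- Truncation of `x` to the interval `[-r, r]`. -/
noncomputable def clamp (r x : ℝ) : ℝ := max (-r) (min x r)

lemma abs_clamp_le {r : ℝ} (hr : 0 ≤ r) (x : ℝ) : |clamp r x| ≤ r := by
  unfold clamp
  rw [abs_le]
  exact ⟨le_max_left _ _, max_le (by linarith) (min_le_right _ _)⟩

lemma clamp_of_abs_le {r x : ℝ} (h : |x| ≤ r) : clamp r x = x := by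
  rw [abs_le] at h
  rw [clamp, min_eq_left h.2, max_eq_right h.1]

lemma clamp_mono (r : ℝ) : Monotone (clamp r) := fun _ _ h =>
  max_le_max_left _ (min_le_min_right _ h)

lemma abs_clamp_sub_le (r s x : ℝ) : |clamp r x - clamp s x| ≤ |r - s| := by
  unfold clamp
  refine (abs_max_sub_max_le_max _ _ _ _).trans (max_le ?_ ?_)
  · rw [neg_sub_neg, abs_sub_comm]
  · refine (abs_min_sub_min_le_max _ _ _ _).trans (max_le ?_ le_rfl)
    simp

lemma measurable_clamp : Measurable fun p : ℝ × ℝ => clamp p.1 p.2 := by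
  unfold clamp
  fun_prop

lemma mul_sub_clamp_nonneg (r t x : ℝ) : 0 ≤ t * (clamp r x - clamp r (x - t)) := by
  rcases le_total 0 t with ht | ht
  · exact mul_nonneg ht (sub_nonneg.2 (clamp_mono r (by linarith)))
  · exact mul_nonneg_of_nonpos_of_nonpos ht (sub_nonpos.2 (clamp_mono r (by linarith)))

namespace StdSummands

variable {ι : Type*} [Fintype ι] {ξ : ι → Ω → ℝ} {δ : ℝ}

/-- A randomized concentration inequality. -/
theorem concentration (h : StdSummands μ ξ δ) (c : ℝ) {D : Ω → ℝ} {D' : ι → Ω → ℝ}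
    (hD : BddMeas D) (hD' : ∀ i, BddMeas (D' i))
    (hind : ∀ i, IndepFun (ξ i) (fun ω => (∑ j, ξ j ω - ξ i ω, D' i ω)) μ) :
    μ.real {ω | |∑ i, ξ i ω - c| ≤ |D ω|} ≤
      ∫ ω, |∑ i, ξ i ω| * |D ω| ∂μ + 2 * δ + ∑ i, ∫ ω, |ξ i ω| * |D ω - D' i ω| ∂μ := by
  have hδ := h.nonneg
  set W : Ω → ℝ := fun ω => ∑ i, ξ i ω with hW
  have hWb : BddMeas W := h.bddMeas_sum
  set S : Set Ω := {ω | |W ω - c| ≤ |D ω|} with hS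
  have hSm : MeasurableSet S :=
    measurableSet_le (hWb.meas.sub_const c).abs hD.meas.abs
  -- The linear window exceeds `|D|` by `δ`, so on `S` both `W` and `W - ξ i` lie inside it.
  set φ : ℝ × ℝ → ℝ := fun p => clamp (|p.2| + δ) (p.1 - c) with hφ
  have hφm : Measurable φ := by
    have : Measurable fun p : ℝ × ℝ => ((|p.2| + δ, p.1 - c) : ℝ × ℝ) := by fun_prop
    exact measurable_clamp.comp this
  have hYm : ∀ i, Measurable fun ω => (W ω - ξ i ω, D' i ω) := fun i =>
    (hWb.meas.sub (h.meas i)).prodMk (hD' i).meas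
  have hφb : ∀ i, BddMeas fun ω => φ (W ω - ξ i ω, D' i ω) := fun i => by
    obtain ⟨C, hC⟩ := (hD' i).bdd
    refine ⟨hφm.comp (hYm i), C + δ, fun ω => (abs_clamp_le (by positivity) _).trans ?_⟩
    have := hC ω
    simp only
    linarith
  have hzero : ∀ i, ∫ ω, ξ i ω * φ (W ω - ξ i ω, D' i ω) ∂μ = 0 := fun i =>
    h.integral_mul_eq_zero (hind i) (hYm i) hφm
  have hpt : ∀ ω, S.indicator (1 : Ω → ℝ) ω ≤ |W ω| * |D ω| + |W ω| * δ +
      |∑ i, ξ i ω ^ 2 - 1| + ∑ i, |ξ i ω| * |D ω - D' i ω| -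
      ∑ i, ξ i ω * φ (W ω - ξ i ω, D' i ω) := by
    intro ω
    -- On `S` the increments of `φ` equal `ξ i`, which gives equality; off `S` the right side is
    -- nonnegative because `φ` is monotone in its first argument.
    have h1 : S.indicator (1 : Ω → ℝ) ω * ∑ i, ξ i ω ^ 2 ≤
        ∑ i, ξ i ω * (φ (W ω, D ω) - φ (W ω - ξ i ω, D ω)) := by
      rw [Finset.mul_sum]
      refine Finset.sum_le_sum fun i _ => ?_
      by_cases hω : ω ∈ S
      · have hω' : |W ω - c| ≤ |D ω| := hω
        have hb := h.bound i ω
        have e1 : φ (W ω, D ω) = W ω - c := clamp_of_abs_le (by linarith)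
        have e2 : φ (W ω - ξ i ω, D ω) = W ω - ξ i ω - c := by
          refine clamp_of_abs_le ?_
          rw [show W ω - ξ i ω - c = (W ω - c) - ξ i ω by ring]
          exact (abs_sub _ _).trans (by linarith)
        rw [e1, e2, Set.indicator_of_mem hω, Pi.one_apply]
        exact le_of_eq (by ring)
      · rw [Set.indicator_of_notMem hω, zero_mul]
        have := mul_sub_clamp_nonneg (|D ω| + δ) (ξ i ω) (W ω - c)
        simp only [hφ]
        rwa [show W ω - ξ i ω - c = W ω - c - ξ i ω by ring]
    -- Replacing `D` by `D' i` isolates a last sum whose terms have mean zero; the replacement costs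
    -- `|D - D' i|` because `clamp` is 1-Lipschitz in its level.
    have h2 : ∑ i, ξ i ω * (φ (W ω, D ω) - φ (W ω - ξ i ω, D ω)) =
        W ω * φ (W ω, D ω) - ∑ i, ξ i ω * (φ (W ω - ξ i ω, D ω) - φ (W ω - ξ i ω, D' i ω))
          - ∑ i, ξ i ω * φ (W ω - ξ i ω, D' i ω) := by
      simp only [hW, mul_sub, Finset.sum_sub_distrib, Finset.sum_mul]
      ring
    have h3 : W ω * φ (W ω, D ω) ≤ |W ω| * |D ω| + |W ω| * δ := by
      rw [← mul_add]
      refine (le_abs_self _).trans ?_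
      rw [abs_mul]
      gcongr
      exact abs_clamp_le (by positivity) _
    have h4 : -∑ i, ξ i ω * (φ (W ω - ξ i ω, D ω) - φ (W ω - ξ i ω, D' i ω)) ≤
        ∑ i, |ξ i ω| * |D ω - D' i ω| := by
      rw [← Finset.sum_neg_distrib]
      refine Finset.sum_le_sum fun i _ => ?_
      refine (neg_le_abs _).trans ?_
      rw [abs_mul]
      refine mul_le_mul_of_nonneg_left ?_ (abs_nonneg _)
      refine (abs_clamp_sub_le _ _ _).trans ?_
      simp only [add_sub_add_right_eq_sub]
      exact abs_abs_sub_abs_le_abs_sub _ _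
    have h5 : S.indicator (1 : Ω → ℝ) ω ≤
        S.indicator (1 : Ω → ℝ) ω * ∑ i, ξ i ω ^ 2 + |∑ i, ξ i ω ^ 2 - 1| := by
      have := neg_abs_le (∑ i, ξ i ω ^ 2 - 1)
      by_cases hω : ω ∈ S
      · simp only [Set.indicator_of_mem hω, Pi.one_apply]; linarith
      · simp [Set.indicator_of_notMem hω]
    linarith
  have i1 := (hWb.abs.mul hD.abs)
  have i2 := (hWb.abs.mul (.const δ))
  have i3 := h.bddMeas_sq.abs
  have i4 : ∀ i, BddMeas fun ω => |ξ i ω| * |D ω - D' i ω| := fun i =>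
    (h.bddMeas i).abs.mul (hD.sub (hD' i)).abs
  have i5 : ∀ i, BddMeas fun ω => ξ i ω * φ (W ω - ξ i ω, D' i ω) := fun i =>
    (h.bddMeas i).mul (hφb i)
  have i4' := BddMeas.sum (s := Finset.univ) fun i _ => i4 i
  have i5' := BddMeas.sum (s := Finset.univ) fun i _ => i5 i
  have hint := integral_mono ((BddMeas.indicator hSm).integrable μ)
    (((((i1.add i2).add i3).add i4').sub i5').integrable μ) hpt
  rw [integral_indicator_one hSm,
    integral_sub ((((i1.add i2).add i3).add i4').integrable μ) (i5'.integrable μ),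
    integral_add (((i1.add i2).add i3).integrable μ) (i4'.integrable μ),
    integral_add ((i1.add i2).integrable μ) (i3.integrable μ),
    integral_add (i1.integrable μ) (i2.integrable μ),
    integral_finsetSum _ (fun i _ => (i4 i).integrable μ),
    integral_finsetSum _ (fun i _ => (i5 i).integrable μ),
    integral_mul_const, Finset.sum_congr rfl (fun i _ => hzero i), Finset.sum_const_zero] at hint
  have j1 := mul_le_mul_of_nonneg_right h.integral_abs_sum_le hδ
  have j2 := h.integral_abs_sq_sub_one_le
  linarith

/-- The Berry–Esseen bound for sums of bounded independent random variables. -/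
theorem berryEsseen (h : StdSummands μ ξ δ)
    (hind : ∀ i, IndepFun (ξ i) (fun ω => ∑ j, ξ j ω - ξ i ω) μ) (z : ℝ) :
    |μ.real {ω | ∑ i, ξ i ω ≤ z} - stdCdf z| ≤ 22 * δ := by
  have hδ := h.nonneg
  -- The bound is trivial for `δ > 1`; below, `δ ≤ 1` absorbs higher powers of `δ`.
  rcases lt_or_ge 1 δ with hδ1 | hδ1
  · have a1 : 0 ≤ μ.real {ω | ∑ i, ξ i ω ≤ z} := measureReal_nonneg
    have a2 : μ.real {ω | ∑ i, ξ i ω ≤ z} ≤ 1 := measureReal_le_one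
    have a3 := stdCdf_nonneg z
    have a4 := stdCdf_le_one z
    rw [abs_le]
    constructor <;> linarith
  set W : Ω → ℝ := fun ω => ∑ i, ξ i ω with hW
  set η : Ω → ℝ := fun ω => ∑ i, ξ i ω ^ 2 - 1 with hη
  have hηb : BddMeas η := h.bddMeas_sq
  have hWb : BddMeas W := h.bddMeas_sum
  have hSm : MeasurableSet {ω | W ω ≤ z} := measurableSet_le hWb.meas measurable_const
  set S : Set Ω := {ω | |W ω - z| ≤ |δ|} with hS
  have hS' : MeasurableSet S := measurableSet_le (hWb.meas.sub_const z).abs measurable_const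
  have hconc : μ.real S ≤ 3 * δ := by
    have := h.concentration z (D := fun _ => δ) (D' := fun _ _ => δ) (.const δ)
      (fun _ => .const δ) fun i => (hind i).comp (φ := id) (ψ := fun x => (x, δ)) measurable_id
        (measurable_id.prodMk measurable_const)
    simp only [sub_self, abs_zero, mul_zero, integral_zero, Finset.sum_const_zero, add_zero,
      integral_mul_const] at this
    have j1 := mul_le_mul_of_nonneg_right h.integral_abs_sum_le (abs_nonneg δ)
    rw [abs_of_nonneg hδ] at j1
    rw [abs_of_nonneg hδ] at this
    simp only [hS, abs_of_nonneg hδ]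
    linarith
  -- The leave-one-out sum has mean zero and can be added freely; what separates it from `W *
  -- steinSol z W` is a first-order Taylor expansion.
  set M : Ω → ℝ := fun ω => ∑ i, ξ i ω * steinSol z (W ω - ξ i ω) with hM
  have hsm := (continuous_steinSol z).measurable
  have hMi : ∀ i, BddMeas fun ω => ξ i ω * steinSol z (W ω - ξ i ω) := fun i =>
    (h.bddMeas i).mul ⟨hsm.comp (hWb.meas.sub (h.meas i)), 6, fun ω => abs_steinSol_le _ _⟩
  have hMb : BddMeas M := BddMeas.sum fun i _ => hMi i
  have hM0 : ∫ ω, M ω ∂μ = 0 := by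
    rw [hM, integral_finsetSum _ fun i _ => (hMi i).integrable μ]
    exact Finset.sum_eq_zero fun i _ =>
      h.integral_mul_eq_zero (hind i) (hWb.meas.sub (h.meas i)) hsm
  have hpt : ∀ ω, |Set.indicator {ω | W ω ≤ z} (1 : Ω → ℝ) ω - stdCdf z + M ω| ≤
      (9 * |η ω| + 2 * δ * |W ω|) + (2 * δ * (|η ω| * |W ω|) + 6 * δ) +
        S.indicator (1 : Ω → ℝ) ω := by
    intro ω
    have hind1 : Set.indicator {ω | W ω ≤ z} (1 : Ω → ℝ) ω = if W ω ≤ z then 1 else 0 := by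
      simp [Set.indicator_apply]
    -- With `≤` in `steinDerivLeft`, Stein's equation holds at every point, including `W ω = z`.
    have e1 : Set.indicator {ω | W ω ≤ z} (1 : Ω → ℝ) ω - stdCdf z =
        steinDerivLeft z (W ω) - W ω * steinSol z (W ω) := by
      rw [hind1, steinDerivLeft]; ring
    have e2 : W ω * steinSol z (W ω) = (η ω + 1) * steinDerivLeft z (W ω) +
        ∑ i, ξ i ω * (steinSol z (W ω) - steinSol z (W ω - ξ i ω) -
          ξ i ω * steinDerivLeft z (W ω)) + M ω := by
      simp only [hW, hM, hη, mul_sub, Finset.sum_sub_distrib, Finset.sum_mul, sub_add_cancel]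
      rw [show ∑ i, ξ i ω * (ξ i ω * steinDerivLeft z (∑ i, ξ i ω)) =
        ∑ i, ξ i ω ^ 2 * steinDerivLeft z (∑ i, ξ i ω) from
          Finset.sum_congr rfl fun i _ => by ring]
      ring
    set T := (2 * |W ω| + 6) * δ + S.indicator (1 : Ω → ℝ) ω with hT
    have hSi0 : 0 ≤ S.indicator (1 : Ω → ℝ) ω := Set.indicator_nonneg (by simp) _
    have hSi1 : S.indicator (1 : Ω → ℝ) ω ≤ 1 :=
      Set.indicator_le_self' (f := (1 : Ω → ℝ)) (by simp) ω
    have e3 : |∑ i, ξ i ω * (steinSol z (W ω) - steinSol z (W ω - ξ i ω) -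
          ξ i ω * steinDerivLeft z (W ω))| ≤ (η ω + 1) * T := by
      refine (Finset.abs_sum_le_sum_abs _ _).trans ?_
      simp only [hη, sub_add_cancel]
      rw [Finset.sum_mul]
      refine Finset.sum_le_sum fun i _ => ?_
      rw [abs_mul, ← sq_abs, pow_two, mul_assoc]
      refine mul_le_mul_of_nonneg_left ?_ (abs_nonneg _)
      refine (abs_steinSol_taylor_le (h.bound i ω)).trans ?_
      refine mul_le_mul_of_nonneg_left ?_ (abs_nonneg _)
      rw [hT]
      refine add_le_add le_rfl (le_of_eq ?_)
      rw [Set.indicator_apply]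
      refine if_congr ?_ rfl rfl
      simp only [hS, Set.mem_ofPred_eq, abs_of_nonneg hδ, abs_le]
      constructor <;> rintro ⟨_, _⟩ <;> constructor <;> linarith
    have e4 : |η ω * steinDerivLeft z (W ω)| ≤ |η ω| * 2 := by
      rw [abs_mul]
      exact mul_le_mul_of_nonneg_left (abs_steinDerivLeft_le _ _) (abs_nonneg _)
    have e5 : (η ω + 1) * T ≤ T + |η ω| * (2 * |W ω| * δ + 7) := by
      have hT0 : 0 ≤ T := by positivity
      have hT1 : T ≤ 2 * |W ω| * δ + 7 := by rw [hT]; nlinarith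
      have := mul_le_mul_of_nonneg_right (le_abs_self (η ω)) hT0
      have := mul_le_mul_of_nonneg_left hT1 (abs_nonneg (η ω))
      linarith
    have e6 : Set.indicator {ω | W ω ≤ z} (1 : Ω → ℝ) ω - stdCdf z + M ω =
        -(η ω * steinDerivLeft z (W ω)) - ∑ i, ξ i ω * (steinSol z (W ω) -
          steinSol z (W ω - ξ i ω) - ξ i ω * steinDerivLeft z (W ω)) := by
      rw [e1, e2]; ring
    rw [e6]
    refine (abs_sub _ _).trans ?_
    rw [abs_neg]
    calc _ ≤ |η ω| * 2 + (T + |η ω| * (2 * |W ω| * δ + 7)) :=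
          add_le_add e4 (e3.trans e5)
      _ = _ := by rw [hT]; ring
  have b0 := ((BddMeas.indicator hSm).sub (.const (stdCdf z))).add hMb
  have b1 := (BddMeas.const (Ω := Ω) 9).mul hηb.abs
  have b2 := (BddMeas.const (Ω := Ω) (2 * δ)).mul hWb.abs
  have b3 := (BddMeas.const (Ω := Ω) (2 * δ)).mul (hηb.abs.mul hWb.abs)
  have b4 := BddMeas.const (Ω := Ω) (6 * δ)
  have b5 := BddMeas.indicator hS'
  have hint := integral_mono (b0.abs.integrable μ)
    ((((b1.add b2).add (b3.add b4)).add b5).integrable μ) hpt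
  rw [integral_add (((b1.add b2).add (b3.add b4)).integrable μ) (b5.integrable μ),
    integral_add ((b1.add b2).integrable μ) ((b3.add b4).integrable μ),
    integral_add (b1.integrable μ) (b2.integrable μ),
    integral_add (b3.integrable μ) (b4.integrable μ), integral_indicator_one hS',
    integral_const_mul, integral_const_mul, integral_const_mul] at hint
  have hle := (abs_integral_le_integral_abs (μ := μ)
    (f := fun ω => Set.indicator {ω | W ω ≤ z} (1 : Ω → ℝ) ω - stdCdf z + M ω)).trans hint
  rw [integral_add (((BddMeas.indicator hSm).sub (.const (stdCdf z))).integrable μ)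
    (hMb.integrable μ), integral_sub ((BddMeas.indicator hSm).integrable μ)
    ((BddMeas.const (stdCdf z)).integrable μ), integral_indicator_one hSm, hM0, add_zero] at hle
  simp only [integral_const, probReal_univ, one_smul] at hle
  -- The terms contribute `9 + 2 + 2 + 6 + 3 = 22` multiples of `δ`, the `3` coming from `hconc`.
  have j1 := h.integral_abs_sum_le
  have j2 := h.integral_abs_sq_sub_one_le
  have j3 : ∫ ω, |η ω| * |W ω| ∂μ ≤ δ := by
    refine (hηb.integral_abs_mul_abs_le hWb μ).trans ?_
    calc _ ≤ δ * 1 := by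
          gcongr
          · exact h.sqrt_integral_sq_sub_one_le
          · exact Real.sqrt_le_one.2 h.integral_sq_sum_le
      _ = δ := mul_one δ
  have j1' := mul_le_mul_of_nonneg_left j1 (show 0 ≤ 2 * δ by linarith)
  have j3' := mul_le_mul_of_nonneg_left j3 (show 0 ≤ 2 * δ by linarith)
  have : 2 * δ * δ ≤ 2 * δ := by nlinarith
  refine hle.trans ?_
  linarith

/-- A Berry–Esseen bound for a perturbation of a sum of independent random variables. -/
theorem berryEsseen_add (h : StdSummands μ ξ δ) {D : Ω → ℝ} {D' : ι → Ω → ℝ}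
    (hD : BddMeas D) (hD' : ∀ i, BddMeas (D' i))
    (hind : ∀ i, IndepFun (ξ i) (fun ω => (∑ j, ξ j ω - ξ i ω, D' i ω)) μ) (z : ℝ) :
    |μ.real {ω | ∑ i, ξ i ω + D ω ≤ z} - stdCdf z| ≤
      24 * δ + √(∫ ω, D ω ^ 2 ∂μ) + ∑ i, ∫ ω, |ξ i ω| * |D ω - D' i ω| ∂μ := by
  have h1 := h.berryEsseen (fun i => (hind i).comp measurable_id measurable_fst) z
  have h2 := h.concentration z hD hD' hind
  have h3 : ∫ ω, |∑ i, ξ i ω| * |D ω| ∂μ ≤ √(∫ ω, D ω ^ 2 ∂μ) := by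
    refine (h.bddMeas_sum.integral_abs_mul_abs_le hD μ).trans ?_
    refine mul_le_of_le_one_left (Real.sqrt_nonneg _) (Real.sqrt_le_one.2 h.integral_sq_sum_le)
  -- The two events differ only where `z` lies between `W` and `W + D`.
  have h4 : |μ.real {ω | ∑ i, ξ i ω + D ω ≤ z} - μ.real {ω | ∑ i, ξ i ω ≤ z}| ≤
      μ.real {ω | |∑ i, ξ i ω - z| ≤ |D ω|} := by
    rw [abs_le]
    constructor
    · rw [neg_le_sub_iff_le_add]
      refine (measureReal_mono ?_).trans (measureReal_union_le _ _)
      intro ω hω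
      simp only [Set.mem_union, Set.mem_ofPred_eq] at hω ⊢
      rw [or_iff_not_imp_left, not_le]
      intro hlt
      rw [abs_of_nonpos (by linarith)]
      linarith [le_abs_self (D ω)]
    · rw [sub_le_iff_le_add']
      refine (measureReal_mono ?_).trans (measureReal_union_le _ _)
      intro ω hω
      simp only [Set.mem_union, Set.mem_ofPred_eq] at hω ⊢
      rw [or_iff_not_imp_left, not_le]
      intro hlt
      rw [abs_of_nonneg (by linarith)]
      linarith [neg_abs_le (D ω)]
  have h5 := abs_sub_le (μ.real {ω | ∑ i, ξ i ω + D ω ≤ z}) (μ.real {ω | ∑ i, ξ i ω ≤ z})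
    (stdCdf z)
  linarith

end StdSummands

end SteinMethod

/-! ### Independence and conditioning on a product of unit intervals. -/

lemma dependsOn_update {ι : Type*} [DecidableEq ι] {E : Type*} {F : (ι → unitInterval) → E} {S : Set ι}
    (hF : DependsOn F S) (c : ι) (t : unitInterval) :
    DependsOn (fun z => F (Function.update z c t)) (S \ {c}) := by
  intro x y hxy
  refine hF fun i hi => ?_
  by_cases hc : i = c
  · subst hc; simp
  · simpa [Function.update_of_ne hc] using hxy i ⟨hi, hc⟩

section ProductSpace

variable {ι ι' : Type*} [Fintype ι] [Fintype ι']

lemma indepFun_of_dependsOn {E₁ E₂ : Type*} [MeasurableSpace E₁] [MeasurableSpace E₂]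
    {F : (ι → unitInterval) → E₁} {G : (ι → unitInterval) → E₂} (hF : Measurable F)
    (hG : Measurable G) {S T : Set ι} (hFS : DependsOn F S) (hGT : DependsOn G T)
    (hST : Disjoint S T) : IndepFun F G volume := by
  classical
  have hind : iIndepFun (fun (i : ι) (z : ι → unitInterval) => z i) volume :=
    iIndepFun_pi (μ := fun _ : ι => (volume : Measure unitInterval)) (X := fun _ => id)
      fun _ => aemeasurable_id
  have h := hind.indepFun_finset S.toFinset T.toFinset (Set.disjoint_toFinset.2 hST)
    fun i => measurable_pi_apply i
  -- `F` and `G` factor through their own coordinates; the remaining ones are filled with the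
  -- arbitrary value `0`.
  let ext (U : Finset ι) (w : U → unitInterval) (i : ι) : unitInterval :=
    if hi : i ∈ U then w ⟨i, hi⟩ else 0
  have hext : ∀ U, Measurable (ext U) := fun U => by
    refine measurable_pi_lambda _ fun i => ?_
    by_cases hi : i ∈ U
    · simpa [ext, hi] using measurable_pi_apply _
    · simp [ext, hi]
  have h' := h.comp (hF.comp (hext _)) (hG.comp (hext _))
  convert h' using 1
  · funext z
    exact hFS fun i hi => by simp [ext, hi]
  · funext z
    exact hGT fun i hi => by simp [ext, hi]

lemma measurePreserving_comp_of_injective {e : ι' → ι} (he : Function.Injective e) :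
    MeasurePreserving (fun (z : ι → unitInterval) (i : ι') => z (e i)) volume volume := by
  refine ⟨measurable_pi_lambda _ fun i => measurable_pi_apply _, ?_⟩
  have hind : iIndepFun (fun (i : ι) (z : ι → unitInterval) => z i) volume :=
    iIndepFun_pi (μ := fun _ : ι => (volume : Measure unitInterval)) (X := fun _ => id)
      fun _ => aemeasurable_id
  have h := (iIndepFun_iff_map_fun_eq_pi_map (f := fun i (z : ι → unitInterval) => z (e i))
    fun i => (measurable_pi_apply (e i)).aemeasurable).1 (hind.precomp he)
  rw [h, volume_pi]
  congr 1
  funext i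
  exact (measurePreserving_eval (fun _ : ι => (volume : Measure unitInterval)) (e i)).map_eq

lemma measurePreserving_update [DecidableEq ι] (c : ι) :
    MeasurePreserving (fun p : unitInterval × (ι → unitInterval) => Function.update p.2 c p.1)
      (volume.prod volume) volume := by
  have hm : Measurable fun p : unitInterval × (ι → unitInterval) => Function.update p.2 c p.1 := by
    refine measurable_pi_lambda _ fun i => ?_
    by_cases hi : i = c
    · subst hi; simpa using measurable_fst
    · simp only [Function.update_of_ne hi]; exact (measurable_pi_apply i).comp measurable_snd
  refine ⟨hm, ?_⟩
  rw [volume_pi]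
  refine Eq.symm (Measure.pi_eq fun s hs => ?_)
  rw [Measure.map_apply hm (MeasurableSet.univ_pi hs)]
  -- The overwritten coordinate of `z` is unconstrained, so its factor is the whole interval, of
  -- measure one.
  have : (fun p : unitInterval × (ι → unitInterval) => Function.update p.2 c p.1) ⁻¹'
      Set.univ.pi s = s c ×ˢ Set.univ.pi (Function.update s c Set.univ) := by
    ext ⟨t, z⟩
    simp only [Set.mem_preimage, Set.mem_univ_pi, Set.mem_prod]
    constructor
    · intro h
      refine ⟨by simpa using h c, fun i => ?_⟩
      by_cases hi : i = c
      · subst hi; simp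
      · simpa [Function.update_of_ne hi] using h i
    · rintro ⟨h1, h2⟩ i
      by_cases hi : i = c
      · subst hi; simpa using h1
      · simpa [Function.update_of_ne hi] using h2 i
  rw [this, Measure.prod_prod, Measure.pi_pi, ← Finset.mul_prod_erase _ _ (Finset.mem_univ c),
    ← Finset.mul_prod_erase Finset.univ (fun i => volume (s i)) (Finset.mem_univ c)]
  simp only [Function.update_self, measure_univ, one_mul]
  congr 1
  refine Finset.prod_congr rfl fun i hi => ?_
  rw [Function.update_of_ne (Finset.ne_of_mem_erase hi)]

lemma integral_eq_integral_update [DecidableEq ι] (c : ι) {F : (ι → unitInterval) → ℝ}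
    (hF : BddMeas F) : ∫ z, F z = ∫ t, ∫ z, F (Function.update z c t) := by
  have h := measurePreserving_update c
  conv_lhs => rw [← h.map_eq]
  rw [integral_map h.measurable.aemeasurable hF.meas.aestronglyMeasurable,
    integral_prod _ ((hF.comp h.measurable).integrable _)]

lemma measurable_update_right [DecidableEq ι] (c : ι) (t : unitInterval) :
    Measurable fun z : ι → unitInterval => Function.update z c t :=
  (measurePreserving_update c).measurable.comp (measurable_const.prodMk measurable_id)

/-- If `F` and `G` share at most the coordinate `c` and `F` is centred given that coordinate, then
they are orthogonal. -/
lemma integral_mul_eq_zero_of_dependsOn [DecidableEq ι] {F G : (ι → unitInterval) → ℝ}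
    (hF : BddMeas F) (hG : BddMeas G) {S T : Set ι} (hFS : DependsOn F S) (hGT : DependsOn G T)
    {c : ι} (hST : S ∩ T ⊆ {c}) (h0 : ∀ t, ∫ z, F (Function.update z c t) = 0) :
    ∫ z, F z * G z = 0 := by
  rw [integral_eq_integral_update c (hF.mul hG)]
  refine (integral_congr_ae (ae_of_all _ fun t => ?_)).trans (integral_zero _ _)
  have hu := measurable_update_right c t
  -- Once the shared coordinate is frozen, `F` and `G` depend on disjoint sets of coordinates.
  have hind : IndepFun (fun z => F (Function.update z c t)) (fun z => G (Function.update z c t))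
      volume := by
    refine indepFun_of_dependsOn (hF.meas.comp hu) (hG.meas.comp hu) (dependsOn_update hFS c t)
      (dependsOn_update hGT c t) ?_
    rw [Set.disjoint_left]
    rintro i ⟨h1, h2⟩ ⟨h3, -⟩
    exact h2 (hST ⟨h1, h3⟩)
  have := hind.integral_fun_mul_eq_mul_integral (hF.meas.comp hu).aestronglyMeasurable
    (hG.meas.comp hu).aestronglyMeasurable
  simp only [this, h0, zero_mul]

end ProductSpace

/-! ### Counting increasing indices through prescribed vertices. -/

section Counting

variable {k n : ℕ}

/-- An increasing index is determined by its range, so the count is that of `k`-subsets containing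
`s`. -/
lemma card_filter_embedding_subset (s : Finset (Fin n)) (hs : s.card ≤ k) :
    (Finset.univ.filter fun α : Fin k ↪o Fin n => ∀ i ∈ s, i ∈ Set.range α).card =
      (n - s.card).choose (k - s.card) := by
  have h := Finset.card_filter_powersetCard_subset s Finset.univ k (Finset.subset_univ s) hs
  rw [Finset.card_univ, Fintype.card_fin] at h
  rw [← h]
  refine Finset.card_bij (fun α _ => Finset.univ.map α.toEmbedding) ?_ ?_ ?_
  · intro α hα
    simp only [Finset.mem_filter, Finset.mem_univ, true_and, Finset.mem_powersetCard,
      Finset.subset_univ, Finset.card_map, Finset.card_univ, Fintype.card_fin] at hα ⊢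
    intro i hi
    obtain ⟨j, hj⟩ := hα i hi
    exact Finset.mem_map.2 ⟨j, Finset.mem_univ j, hj⟩
  · intro α _ β _ hαβ
    have := congrArg (fun t : Finset (Fin n) => (t : Set (Fin n))) hαβ
    simp only [Finset.coe_map, Finset.coe_univ, Set.image_univ] at this
    exact OrderEmbedding.range_inj.1 this
  · intro t ht
    simp only [Finset.mem_filter, Finset.mem_powersetCard, Finset.subset_univ, true_and] at ht
    refine ⟨t.orderEmbOfFin ht.1, ?_, ?_⟩
    · simp only [Finset.mem_filter, Finset.mem_univ, true_and, Finset.range_orderEmbOfFin,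
        Finset.mem_coe]
      exact fun i hi => ht.2 hi
    · rw [← Finset.coe_inj]
      simp

lemma card_embedding : Fintype.card (Fin k ↪o Fin n) = n.choose k := by
  have := card_filter_embedding_subset (k := k) (∅ : Finset (Fin n)) (by simp)
  simpa using this

lemma card_filter_embedding_mem [NeZero k] (i : Fin n) :
    (n : ℝ) * (Finset.univ.filter fun α : Fin k ↪o Fin n => i ∈ Set.range α).card =
      k * n.choose k := by
  have hk := Nat.pos_of_ne_zero (NeZero.ne k)
  have h := card_filter_embedding_subset (k := k) {i} (by rw [Finset.card_singleton]; exact hk)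
  simp only [Finset.mem_singleton, forall_eq, Finset.card_singleton] at h
  rw [h]
  obtain ⟨k, rfl⟩ := Nat.exists_eq_succ_of_ne_zero hk.ne'
  obtain ⟨n, rfl⟩ := Nat.exists_eq_succ_of_ne_zero (Fin.pos i).ne'
  have := Nat.add_one_mul_choose_eq n k
  rw [mul_comm]
  simp only [Nat.succ_eq_add_one, Nat.add_sub_cancel]
  exact_mod_cast by linarith

/-- For `k ≥ 2` the exact proportion is `k(k-1) / (n(n-1))`; the factor `2` pays for replacing
`n(n-1)` by `n ^ 2`, as `n ≥ 2`. -/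
lemma card_filter_embedding_mem_mem {i j : Fin n} (hij : i ≠ j) :
    ((Finset.univ.filter fun α : Fin k ↪o Fin n =>
      i ∈ Set.range α ∧ j ∈ Set.range α).card : ℝ) ≤ 2 * k ^ 2 / n ^ 2 * n.choose k := by
  have hn : 2 ≤ n := by
    have h1 := i.2
    have h2 := j.2
    have h3 : i.val ≠ j.val := fun h => hij (Fin.ext h)
    omega
  rcases lt_or_ge k 2 with hk | hk
  · rw [Finset.filter_false_of_mem, Finset.card_empty]
    · simp only [Nat.cast_zero]; positivity
    · rintro α - ⟨⟨a, ha⟩, ⟨b, hb⟩⟩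
      have : a = b := Fin.ext (by have := a.2; have := b.2; omega)
      exact hij (by rw [← ha, ← hb, this])
  have h := card_filter_embedding_subset (k := k) {i, j}
    (by rwa [Finset.card_pair hij])
  rw [Finset.card_pair hij] at h
  simp only [Finset.mem_insert, Finset.mem_singleton, forall_eq_or_imp, forall_eq] at h
  rw [h]
  obtain ⟨k, rfl⟩ := Nat.exists_eq_add_of_le' hk
  obtain ⟨n, rfl⟩ := Nat.exists_eq_add_of_le' hn
  simp only [Nat.add_sub_cancel]
  have e1 := Nat.add_one_mul_choose_eq n k
  have e2 := Nat.add_one_mul_choose_eq (n + 1) (k + 1)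
  have e1' : ((n : ℝ) + 1) * n.choose k = (n + 1).choose (k + 1) * (k + 1) := by exact_mod_cast e1
  have e2' : ((n : ℝ) + 2) * (n + 1).choose (k + 1) = (n + 2).choose (k + 2) * (k + 2) := by
    have : ((n + 1 + 1 : ℕ) : ℝ) * (n + 1).choose (k + 1) =
      (n + 2).choose (k + 2) * ((k + 1 + 1 : ℕ) : ℝ) := by exact_mod_cast e2
    push_cast at this
    linarith
  rw [div_mul_eq_mul_div, le_div_iff₀ (by positivity)]
  push_cast
  have c0 : (0 : ℝ) ≤ (n + 2).choose (k + 2) := by positivity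
  have c1 : (0 : ℝ) ≤ n.choose k := by positivity
  have hk0 : (0 : ℝ) ≤ k := by positivity
  have hn0 : (0 : ℝ) ≤ n := by positivity
  have e3 : (n.choose k : ℝ) * ((n + 1) * (n + 2)) =
      (n + 2).choose (k + 2) * ((k + 1) * (k + 2)) := by
    linear_combination (n + 2 : ℝ) * e1' + (k + 1 : ℝ) * e2'
  have e4 : ((n : ℝ) + 2) ^ 2 ≤ 2 * ((n + 1) * (n + 2)) := by nlinarith
  calc (n.choose k : ℝ) * (n + 2) ^ 2 ≤ n.choose k * (2 * ((n + 1) * (n + 2))) := by gcongr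
    _ = 2 * (n.choose k * ((n + 1) * (n + 2))) := by ring
    _ = 2 * ((k + 1) * (k + 2)) * (n + 2).choose (k + 2) := by rw [e3]; ring
    _ ≤ 2 * (k + 2) ^ 2 * (n + 2).choose (k + 2) := by gcongr; nlinarith

end Counting

/-! ### Shared variables and overlapping indices. -/

section VertexMap

variable {k n : ℕ}

/-- The embedding of the index set of the variables `X_i`, `Y_{i,j}` on `k` vertices into that on
`n` vertices which is induced by an increasing index. -/
def indexMap (α : Fin k ↪o Fin n) : Fin k ⊕ Pairs k → Fin n ⊕ Pairs n :=
  Sum.map α (mapPair α)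

lemma indexMap_injective (α : Fin k ↪o Fin n) : Function.Injective (indexMap α) := by
  refine α.injective.sumMap fun p q hpq => ?_
  have h := congrArg Subtype.val hpq
  simp only [mapPair, Prod.mk.injEq, EmbeddingLike.apply_eq_iff_eq] at h
  exact Subtype.ext (Prod.ext h.1 h.2)

/-- Two increasing indices that have two distinct values in common. -/
def Overlap (α β : Fin k ↪o Fin n) : Prop :=
  ∃ a b, a ≠ b ∧ (a ∈ Set.range α ∧ b ∈ Set.range α) ∧ (a ∈ Set.range β ∧ b ∈ Set.range β)

/-- A shared `Y`-variable would force both of its endpoints to be shared, so without overlap only a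
single `X`-variable can be common. -/
lemma exists_range_inter_subset [NeZero k] {α β : Fin k ↪o Fin n} (h : ¬ Overlap α β) :
    ∃ j, Set.range (indexMap α) ∩ Set.range (indexMap β) ⊆ {Sum.inl (α j)} := by
  have hinr : ∀ p, ¬ (Sum.inr p ∈ Set.range (indexMap α) ∧ Sum.inr p ∈ Set.range (indexMap β)) := by
    rintro p ⟨⟨v, hv⟩, ⟨w, hw⟩⟩
    rcases v with v | v <;> rcases w with w | w <;> simp [indexMap] at hv hw
    refine h ⟨p.1.1, p.1.2, p.2.ne, ⟨⟨v.1.1, ?_⟩, ⟨v.1.2, ?_⟩⟩, ⟨⟨w.1.1, ?_⟩, ⟨w.1.2, ?_⟩⟩⟩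
    · rw [← hv]; rfl
    · rw [← hv]; rfl
    · rw [← hw]; rfl
    · rw [← hw]; rfl
  have hinl : ∀ i (γ : Fin k ↪o Fin n), Sum.inl i ∈ Set.range (indexMap γ) → i ∈ Set.range γ := by
    rintro i γ ⟨v, hv⟩
    rcases v with v | v <;> simp [indexMap] at hv
    exact ⟨v, hv⟩
  by_cases hj : ∃ j, α j ∈ Set.range β
  · obtain ⟨j, hj⟩ := hj
    refine ⟨j, ?_⟩
    rintro (i | p) ⟨h1, h2⟩
    · by_contra hne
      refine h ⟨i, α j, fun hi => hne (by rw [hi]; rfl), ⟨hinl i α h1, j, rfl⟩, hinl i β h2, hj⟩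
    · exact (hinr p ⟨h1, h2⟩).elim
  -- No vertex is shared and the intersection is empty, so any `j` will do.
  · refine ⟨0, ?_⟩
    rintro (i | p) ⟨h1, h2⟩
    · obtain ⟨j, rfl⟩ := hinl i α h1
      exact (hj ⟨j, hinl _ β h2⟩).elim
    · exact (hinr p ⟨h1, h2⟩).elim

-- Union bound over the ordered pair of shared vertices.
open Classical in
lemma card_overlap_le :
    ((Finset.univ.filter fun p : (Fin k ↪o Fin n) × (Fin k ↪o Fin n) =>
      Overlap p.1 p.2).card : ℝ) ≤ n ^ 2 * (2 * k ^ 2 / n ^ 2 * n.choose k) ^ 2 := by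
  set P : Fin n × Fin n → Finset (Fin k ↪o Fin n) := fun q =>
    Finset.univ.filter fun α => q.1 ∈ Set.range α ∧ q.2 ∈ Set.range α with hP
  have hsub : (Finset.univ.filter fun p : (Fin k ↪o Fin n) × (Fin k ↪o Fin n) =>
      Overlap p.1 p.2) ⊆ Finset.univ.offDiag.biUnion fun q => P q ×ˢ P q := by
    rintro ⟨α, β⟩ hp
    obtain ⟨a, b, hab, hα, hβ⟩ := (Finset.mem_filter.1 hp).2
    refine Finset.mem_biUnion.2 ⟨(a, b), by simpa using hab, ?_⟩
    simp only [hP, Finset.mem_product, Finset.mem_filter, Finset.mem_univ, true_and]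
    exact ⟨hα, hβ⟩
  have h1 := (Finset.card_le_card hsub).trans Finset.card_biUnion_le
  calc ((Finset.univ.filter fun p : (Fin k ↪o Fin n) × (Fin k ↪o Fin n) =>
      Overlap p.1 p.2).card : ℝ)
      ≤ ∑ q ∈ Finset.univ.offDiag, ((P q ×ˢ P q).card : ℝ) := by exact_mod_cast h1
    _ ≤ ∑ q ∈ (Finset.univ : Finset (Fin n)).offDiag,
          (2 * k ^ 2 / n ^ 2 * n.choose k : ℝ) ^ 2 := by
        refine Finset.sum_le_sum fun q hq => ?_
        have hq' : q.1 ≠ q.2 := (Finset.mem_offDiag.1 hq).2.2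
        have := card_filter_embedding_mem_mem (k := k) hq'
        rw [Finset.card_product, Nat.cast_mul, ← pow_two]
        gcongr
    _ ≤ _ := by
        rw [Finset.sum_const, nsmul_eq_mul]
        gcongr
        rw [Finset.offDiag_card, Finset.card_univ, Fintype.card_fin, pow_two]
        exact_mod_cast Nat.sub_le _ _

-- One shared vertex is already prescribed, so the union runs over `n` choices instead of `n ^ 2`.
-- This gain compensates the later sum over `i`.
open Classical in
lemma card_overlap_mem_le (i : Fin n) :
    ((Finset.univ.filter fun p : (Fin k ↪o Fin n) × (Fin k ↪o Fin n) =>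
      i ∈ Set.range p.1 ∧ i ∈ Set.range p.2 ∧ Overlap p.1 p.2).card : ℝ) ≤
      n * (2 * k ^ 2 / n ^ 2 * n.choose k) ^ 2 := by
  set P : Fin n → Finset (Fin k ↪o Fin n) := fun b =>
    Finset.univ.filter fun α => i ∈ Set.range α ∧ b ∈ Set.range α with hP
  have hsub : (Finset.univ.filter fun p : (Fin k ↪o Fin n) × (Fin k ↪o Fin n) =>
      i ∈ Set.range p.1 ∧ i ∈ Set.range p.2 ∧ Overlap p.1 p.2) ⊆
      (Finset.univ.erase i).biUnion fun b => P b ×ˢ P b := by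
    rintro ⟨α, β⟩ hp
    obtain ⟨hiα, hiβ, a, b, hab, hα, hβ⟩ := (Finset.mem_filter.1 hp).2
    have : ∃ c, c ≠ i ∧ c ∈ Set.range α ∧ c ∈ Set.range β := by
      by_cases hai : a = i
      · exact ⟨b, fun hb => hab (hai.trans hb.symm), hα.2, hβ.2⟩
      · exact ⟨a, hai, hα.1, hβ.1⟩
    obtain ⟨c, hc, hcα, hcβ⟩ := this
    refine Finset.mem_biUnion.2 ⟨c, by simpa using hc, ?_⟩
    simp only [hP, Finset.mem_product, Finset.mem_filter, Finset.mem_univ, true_and]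
    exact ⟨⟨hiα, hcα⟩, hiβ, hcβ⟩
  have h1 := (Finset.card_le_card hsub).trans Finset.card_biUnion_le
  calc ((Finset.univ.filter fun p : (Fin k ↪o Fin n) × (Fin k ↪o Fin n) =>
      i ∈ Set.range p.1 ∧ i ∈ Set.range p.2 ∧ Overlap p.1 p.2).card : ℝ)
      ≤ ∑ b ∈ Finset.univ.erase i, ((P b ×ˢ P b).card : ℝ) := by exact_mod_cast h1
    _ ≤ ∑ b ∈ (Finset.univ : Finset (Fin n)).erase i,
          (2 * k ^ 2 / n ^ 2 * n.choose k : ℝ) ^ 2 := by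
        refine Finset.sum_le_sum fun b hb => ?_
        have := card_filter_embedding_mem_mem (k := k) (Finset.ne_of_mem_erase hb).symm
        rw [Finset.card_product, Nat.cast_mul, ← pow_two]
        gcongr
    _ ≤ _ := by
        rw [Finset.sum_const, nsmul_eq_mul]
        gcongr
        have := Finset.card_le_univ ((Finset.univ : Finset (Fin n)).erase i)
        rwa [Fintype.card_fin] at this

end VertexMap

/-! ### Hoeffding decomposition and the bound for U-statistics. -/

/-- A bounded kernel of the variables `X_i`, `Y_{i,j}` on `k` vertices whose conditional
expectation given `X_i` does not depend on `i`. -/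
structure SymmKernel (k : ℕ) where
  f : (Fin k ⊕ Pairs k → unitInterval) → ℝ
  proj : unitInterval → ℝ
  bound : ℝ
  meas : Measurable f
  abs_le : ∀ z, |f z| ≤ bound
  proj_eq : ∀ (j : Fin k) t, ∫ z, f (Function.update z (Sum.inl j) t) = proj t

namespace SymmKernel

variable {k n : ℕ} (K : SymmKernel k)

/-- The mean of the kernel. -/
noncomputable def mean : ℝ := ∫ t, K.proj t

/-- The centred projection. -/
noncomputable def cproj (t : unitInterval) : ℝ := K.proj t - K.mean

/-- The part of the kernel at `α` that is orthogonal to the projections. -/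
noncomputable def rem (α : Fin k ↪o Fin n) (z : Fin n ⊕ Pairs n → unitInterval) : ℝ :=
  K.f (fun v => z (indexMap α v)) - K.mean - ∑ j, K.cproj (z (Sum.inl (α j)))

lemma bddMeas_f : BddMeas K.f := ⟨K.meas, K.bound, K.abs_le⟩

lemma bound_nonneg : 0 ≤ K.bound := (abs_nonneg _).trans (K.abs_le fun _ => 0)

lemma abs_integral_le_of_abs_le {E : Type*} [MeasureSpace E]
    [IsProbabilityMeasure (volume : Measure E)] {F : E → ℝ} {C : ℝ} (h : ∀ x, |F x| ≤ C) :
    |∫ x, F x| ≤ C := by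
  have := norm_integral_le_of_norm_le_const (μ := (volume : Measure E)) (f := F) (C := C)
    (ae_of_all _ h)
  simpa using this

lemma integral_comp_eval {ι : Type*} [Fintype ι] {F : unitInterval → ℝ} (hF : Measurable F)
    (v : ι) : ∫ z : ι → unitInterval, F (z v) = ∫ t, F t := by
  have h := measurePreserving_eval (fun _ : ι => (volume : Measure unitInterval)) v
  conv_rhs => rw [← h.map_eq]
  rw [integral_map h.measurable.aemeasurable hF.aestronglyMeasurable]
  rfl

lemma integral_comp_indexMap (α : Fin k ↪o Fin n)
    {F : (Fin k ⊕ Pairs k → unitInterval) → ℝ} (hF : Measurable F) :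
    ∫ z : Fin n ⊕ Pairs n → unitInterval, F (fun v => z (indexMap α v)) = ∫ z, F z := by
  have h := measurePreserving_comp_of_injective (indexMap_injective α)
  conv_rhs => rw [← h.map_eq]
  rw [integral_map h.measurable.aemeasurable hF.aestronglyMeasurable]

lemma bddMeas_f_indexMap (α : Fin k ↪o Fin n) :
    BddMeas fun z : Fin n ⊕ Pairs n → unitInterval => K.f (fun v => z (indexMap α v)) :=
  K.bddMeas_f.comp (measurePreserving_comp_of_injective (indexMap_injective α)).measurable

lemma dependsOn_rem (α : Fin k ↪o Fin n) : DependsOn (K.rem α) (Set.range (indexMap α)) := by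
  intro x y hxy
  have h1 : ∀ v, x (indexMap α v) = y (indexMap α v) := fun v => hxy _ ⟨v, rfl⟩
  have h2 : ∀ j, x (Sum.inl (α j)) = y (Sum.inl (α j)) := fun j => h1 (Sum.inl j)
  simp only [rem, h1, h2]

/-- The `U`-statistic of the kernel. -/
noncomputable def ustat (z : Fin n ⊕ Pairs n → unitInterval) : ℝ :=
  ∑ α : Fin k ↪o Fin n, K.f (fun v => z (indexMap α v))

lemma bddMeas_ustat : BddMeas (K.ustat (n := n)) := BddMeas.sum fun α _ => K.bddMeas_f_indexMap α

variable [NeZero k]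

lemma abs_proj_le (t : unitInterval) : |K.proj t| ≤ K.bound := by
  rw [← K.proj_eq 0 t]
  exact abs_integral_le_of_abs_le fun z => K.abs_le _

lemma measurable_proj : Measurable K.proj := by
  have h : K.proj = fun t => ∫ z, K.f (Function.update z (Sum.inl 0) t) :=
    funext fun t => (K.proj_eq 0 t).symm
  rw [h]
  have hm := K.meas.comp (measurePreserving_update (Sum.inl (0 : Fin k) : Fin k ⊕ Pairs k)).measurable
  exact (StronglyMeasurable.integral_prod_right (ν := volume)
    (f := fun t z => K.f (Function.update z (Sum.inl 0) t)) hm.stronglyMeasurable).measurable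

lemma abs_mean_le : |K.mean| ≤ K.bound := abs_integral_le_of_abs_le K.abs_proj_le

lemma abs_cproj_le (t : unitInterval) : |K.cproj t| ≤ 2 * K.bound := by
  have := abs_sub (K.proj t) K.mean
  have := K.abs_proj_le t
  have := K.abs_mean_le
  unfold cproj
  linarith

lemma bddMeas_cproj : BddMeas K.cproj :=
  ⟨K.measurable_proj.sub_const _, _, K.abs_cproj_le⟩

lemma bddMeas_cproj_eval {ι : Type*} (v : ι) :
    BddMeas fun z : ι → unitInterval => K.cproj (z v) :=
  K.bddMeas_cproj.comp (measurable_pi_apply v)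

lemma integral_cproj : ∫ t, K.cproj t = 0 := by
  unfold cproj
  rw [integral_sub _ (integrable_const _)]
  · simp [mean]
  · exact (BddMeas.mk K.measurable_proj ⟨_, K.abs_proj_le⟩).integrable _

lemma integral_f : ∫ z, K.f z = K.mean := by
  rw [integral_eq_integral_update (Sum.inl (0 : Fin k)) K.bddMeas_f]
  simp only [K.proj_eq, mean]

lemma bddMeas_rem (α : Fin k ↪o Fin n) : BddMeas (K.rem α) :=
  ((K.bddMeas_f_indexMap α).sub (.const _)).sub
    (BddMeas.sum fun _ _ => K.bddMeas_cproj_eval _)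

lemma abs_rem_le (α : Fin k ↪o Fin n) (z : Fin n ⊕ Pairs n → unitInterval) :
    |K.rem α z| ≤ 2 * K.bound * (k + 1) := by
  have h1 := K.abs_le fun v => z (indexMap α v)
  have h2 := K.abs_mean_le
  have h3 : |∑ j, K.cproj (z (Sum.inl (α j)))| ≤ k * (2 * K.bound) := by
    refine (Finset.abs_sum_le_sum_abs _ _).trans ?_
    refine (Finset.sum_le_sum fun j _ => K.abs_cproj_le _).trans ?_
    simp
  unfold rem
  have := abs_sub (K.f (fun v => z (indexMap α v)) - K.mean) (∑ j, K.cproj (z (Sum.inl (α j))))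
  have := abs_sub (K.f (fun v => z (indexMap α v))) K.mean
  linarith

/-- Given `X_{α j} = t`, the kernel averages to `proj t`, and of the projections only the `j`-th
survives, as `proj t - mean`; everything cancels. -/
lemma integral_rem_update (α : Fin k ↪o Fin n) (j : Fin k) (t : unitInterval) :
    ∫ z, K.rem α (Function.update z (Sum.inl (α j)) t) = 0 := by
  have hu := measurable_update_right (Sum.inl (α j) : Fin n ⊕ Pairs n) t
  have e1 : ∫ z : Fin n ⊕ Pairs n → unitInterval,
      K.f (fun v => Function.update z (Sum.inl (α j)) t (indexMap α v)) = K.proj t := by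
    rw [← K.proj_eq j t]
    refine Eq.trans ?_ (integral_comp_indexMap α
      (K.meas.comp (measurable_update_right (Sum.inl j : Fin k ⊕ Pairs k) t)))
    congr 1
    funext z
    refine congrArg K.f (funext fun v => ?_)
    exact Function.update_comp_eq_of_injective' z (indexMap_injective α) (Sum.inl j) t ▸ rfl
  have e2 : ∀ l, ∫ z : Fin n ⊕ Pairs n → unitInterval,
      K.cproj (Function.update z (Sum.inl (α j)) t (Sum.inl (α l))) =
        if l = j then K.cproj t else 0 := by
    intro l
    by_cases hl : l = j
    · subst hl
      simp
    · have : (Sum.inl (α l) : Fin n ⊕ Pairs n) ≠ Sum.inl (α j) := by simpa using hl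
      simp only [Function.update_of_ne this, if_neg hl]
      rw [integral_comp_eval K.bddMeas_cproj.meas, K.integral_cproj]
  have i1 := (K.bddMeas_f_indexMap α).comp hu
  have i2 : ∀ l, BddMeas fun z : Fin n ⊕ Pairs n → unitInterval =>
      K.cproj (Function.update z (Sum.inl (α j)) t (Sum.inl (α l))) := fun l =>
    (K.bddMeas_cproj_eval (Sum.inl (α l))).comp hu
  unfold rem
  rw [integral_sub ((i1.sub (.const _)).integrable _)
    ((BddMeas.sum fun l _ => i2 l).integrable _), integral_sub (i1.integrable _)
    (integrable_const _), integral_finsetSum _ fun l _ => (i2 l).integrable _, e1,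
    Finset.sum_congr rfl fun l _ => e2 l]
  simp [cproj]

lemma integral_rem_mul_rem {α β : Fin k ↪o Fin n} (h : ¬ Overlap α β) :
    ∫ z, K.rem α z * K.rem β z = 0 := by
  obtain ⟨j, hj⟩ := exists_range_inter_subset h
  exact integral_mul_eq_zero_of_dependsOn (K.bddMeas_rem α) (K.bddMeas_rem β)
    (K.dependsOn_rem α) (K.dependsOn_rem β) hj (K.integral_rem_update α j)

-- Expanding the square, only overlapping pairs survive by orthogonality, and each is bounded by the
-- squared supremum of `rem`.
open Classical in
lemma integral_sq_sum_rem_le (A : Finset (Fin k ↪o Fin n)) :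
    ∫ z, (∑ α ∈ A, K.rem α z) ^ 2 ≤ (2 * K.bound * (k + 1)) ^ 2 *
      ((A ×ˢ A).filter fun p => Overlap p.1 p.2).card := by
  have hb : ∀ p : (Fin k ↪o Fin n) × (Fin k ↪o Fin n),
      BddMeas fun z => K.rem p.1 z * K.rem p.2 z := fun p =>
    (K.bddMeas_rem p.1).mul (K.bddMeas_rem p.2)
  have e : ∀ z, (∑ α ∈ A, K.rem α z) ^ 2 = ∑ p ∈ A ×ˢ A, K.rem p.1 z * K.rem p.2 z := fun z => by
    rw [pow_two, Finset.sum_mul_sum, Finset.sum_product]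
  simp only [e]
  rw [integral_finsetSum _ fun p _ => (hb p).integrable _]
  rw [← Finset.sum_filter_add_sum_filter_not (A ×ˢ A) fun p => Overlap p.1 p.2]
  rw [Finset.sum_eq_zero (s := (A ×ˢ A).filter fun p => ¬ Overlap p.1 p.2) fun p hp =>
    K.integral_rem_mul_rem (Finset.mem_filter.1 hp).2, add_zero, mul_comm, ← nsmul_eq_mul]
  refine Finset.sum_le_card_nsmul _ _ _ fun p _ => (le_abs_self _).trans ?_
  refine abs_integral_le_of_abs_le fun z => ?_
  rw [abs_mul, pow_two]
  exact mul_le_mul (K.abs_rem_le _ _) (K.abs_rem_le _ _) (abs_nonneg _)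
    ((abs_nonneg _).trans (K.abs_rem_le p.1 z))

lemma integral_ustat : ∫ z, K.ustat (n := n) z = n.choose k * K.mean := by
  unfold ustat
  rw [integral_finsetSum _ fun α _ => (K.bddMeas_f_indexMap α).integrable _]
  simp only [integral_comp_indexMap _ K.meas, K.integral_f, Finset.sum_const, Finset.card_univ,
    card_embedding, nsmul_eq_mul]

/-- Every vertex lies in the same number `k * n.choose k / n` of increasing indices, so the
projections collect into a multiple of one sum over vertices. -/
lemma ustat_sub_eq (hn : 0 < n) (z : Fin n ⊕ Pairs n → unitInterval) :
    K.ustat z - n.choose k * K.mean = k * n.choose k / n * ∑ i, K.cproj (z (Sum.inl i)) +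
      ∑ α : Fin k ↪o Fin n, K.rem α z := by
  classical
  have h1 : ∑ α : Fin k ↪o Fin n, ∑ j, K.cproj (z (Sum.inl (α j))) =
      k * n.choose k / n * ∑ i, K.cproj (z (Sum.inl i)) := by
    have h2 : ∀ α : Fin k ↪o Fin n, ∑ j, K.cproj (z (Sum.inl (α j))) =
        ∑ i, if i ∈ Set.range α then K.cproj (z (Sum.inl i)) else 0 := fun α => by
      rw [← Finset.sum_filter]
      refine Finset.sum_bij (fun j _ => α j) (fun j _ => by simp) (fun a _ b _ h => α.injective h)
        (fun i hi => ?_) fun j _ => rfl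
      obtain ⟨j, hj⟩ := (Finset.mem_filter.1 hi).2
      exact ⟨j, Finset.mem_univ j, hj⟩
    simp only [h2]
    rw [Finset.sum_comm, Finset.mul_sum]
    refine Finset.sum_congr rfl fun i _ => ?_
    rw [← Finset.sum_filter, Finset.sum_const, nsmul_eq_mul]
    congr 1
    rw [eq_div_iff (by positivity), mul_comm]
    exact card_filter_embedding_mem i
  unfold rem ustat
  rw [Finset.sum_sub_distrib, Finset.sum_sub_distrib, h1, Finset.sum_const, Finset.card_univ,
    card_embedding, nsmul_eq_mul]
  ring

variable {σ : ℝ}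

lemma stdSummands (hn : 0 < n) (hσ : 0 < σ) (hvar : ∫ t, K.cproj t ^ 2 = σ ^ 2) :
    StdSummands volume
      (fun (i : Fin n) (z : Fin n ⊕ Pairs n → unitInterval) =>
        (σ * √n)⁻¹ * K.cproj (z (Sum.inl i))) ((σ * √n)⁻¹ * (2 * K.bound)) where
  meas i := (K.bddMeas_cproj_eval _).meas.const_mul _
  bound i z := by
    rw [abs_mul, abs_of_nonneg (by positivity)]
    exact mul_le_mul_of_nonneg_left (K.abs_cproj_le _) (by positivity)
  mean i := by
    rw [integral_const_mul, integral_comp_eval K.bddMeas_cproj.meas, K.integral_cproj, mul_zero]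
  var := by
    simp only [mul_pow, integral_const_mul]
    simp only [integral_comp_eval K.bddMeas_cproj.sq.meas, hvar, Finset.sum_const,
      Finset.card_univ, Fintype.card_fin, nsmul_eq_mul]
    rw [inv_pow, mul_pow, Real.sq_sqrt (by positivity)]
    field_simp
  indep i j hij := by
    refine indepFun_of_dependsOn (S := {Sum.inl i}) (T := {Sum.inl j}) ?_ ?_ ?_ ?_ ?_
    · exact (K.bddMeas_cproj_eval _).meas.const_mul _
    · exact (K.bddMeas_cproj_eval _).meas.const_mul _
    · intro x y hxy
      simp [hxy _ rfl]
    · intro x y hxy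
      simp [hxy _ rfl]
    · simpa using hij

/-- The Berry–Esseen bound for the `U`-statistic of a kernel. -/
theorem ustat_berryEsseen (hkn : k ≤ n) (hσ : 0 < σ) (hvar : ∫ t, K.cproj t ^ 2 = σ ^ 2) (x : ℝ) :
    |(volume : Measure (Fin n ⊕ Pairs n → unitInterval)).real
      {z | √n / (k * σ) * (n.choose k : ℝ)⁻¹ * (K.ustat z - n.choose k * K.mean) ≤ x} - stdCdf x| ≤
      K.bound * (48 + 8 * k * (k + 1)) / σ * (√n)⁻¹ := by
  classical
  have hk : 0 < k := Nat.pos_of_ne_zero (NeZero.ne k)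
  have hn : 0 < n := hk.trans_le hkn
  have hN : 0 < n.choose k := Nat.choose_pos hkn
  have hB := K.bound_nonneg
  have hs : 0 < √(n : ℝ) := by positivity
  have hss : √(n : ℝ) ^ 2 = n := Real.sq_sqrt (by positivity)
  set ξ : Fin n → (Fin n ⊕ Pairs n → unitInterval) → ℝ := fun i z =>
    (σ * √n)⁻¹ * K.cproj (z (Sum.inl i)) with hξ
  have hstd : StdSummands volume ξ ((σ * √n)⁻¹ * (2 * K.bound)) := K.stdSummands hn hσ hvar
  set c : ℝ := √n / (k * σ) * (n.choose k : ℝ)⁻¹ with hc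
  have hc0 : 0 ≤ c := by positivity
  set D : (Fin n ⊕ Pairs n → unitInterval) → ℝ := fun z =>
    c * ∑ α : Fin k ↪o Fin n, K.rem α z with hD
  -- Terms whose index avoids `i` do not involve `X_i`, so `D' i` is a function of the other
  -- coordinates.
  set D' : Fin n → (Fin n ⊕ Pairs n → unitInterval) → ℝ := fun i z =>
    c * ∑ α ∈ Finset.univ.filter fun α : Fin k ↪o Fin n => i ∉ Set.range α, K.rem α z with hD'
  have hDb : BddMeas D := (BddMeas.const c).mul (BddMeas.sum fun α _ => K.bddMeas_rem α)
  have hDb' : ∀ i, BddMeas (D' i) := fun i =>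
    (BddMeas.const c).mul (BddMeas.sum fun α _ => K.bddMeas_rem α)
  have hind : ∀ i, IndepFun (ξ i) (fun z => (∑ j, ξ j z - ξ i z, D' i z)) volume := by
    intro i
    refine indepFun_of_dependsOn (S := {Sum.inl i}) (T := {Sum.inl i}ᶜ) (hstd.meas i)
      ((hstd.bddMeas_sum.meas.sub (hstd.meas i)).prodMk (hDb' i).meas) ?_ ?_ disjoint_compl_right
    · intro y z hyz
      simp [hξ, hyz _ rfl]
    · intro y z hyz
      have h1 : ∑ j, ξ j y - ξ i y = ∑ j, ξ j z - ξ i z := by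
        rw [← Finset.sum_erase_eq_sub (Finset.mem_univ i),
          ← Finset.sum_erase_eq_sub (Finset.mem_univ i)]
        refine Finset.sum_congr rfl fun j hj => ?_
        have : (Sum.inl j : Fin n ⊕ Pairs n) ∈ ({Sum.inl i}ᶜ : Set (Fin n ⊕ Pairs n)) := by
          simpa using Finset.ne_of_mem_erase hj
        simp [hξ, hyz _ this]
      have h2 : D' i y = D' i z := by
        simp only [hD']
        congr 1
        refine Finset.sum_congr rfl fun α hα => K.dependsOn_rem α fun v hv => hyz v ?_
        rintro rfl
        obtain ⟨w, hw⟩ := hv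
        rcases w with w | w <;> simp [indexMap] at hw
        exact (Finset.mem_filter.1 hα).2 ⟨w, hw⟩
      simp only [h1, h2]
  have hmain := hstd.berryEsseen_add hDb hDb' hind x
  have hset : ∀ z, ∑ i, ξ i z + D z = c * (K.ustat z - n.choose k * K.mean) := by
    intro z
    rw [K.ustat_sub_eq hn, mul_add, ← mul_assoc, hξ, ← Finset.mul_sum]
    congr 2
    rw [hc]
    field_simp
    rw [hss]
  simp only [hset] at hmain
  refine hmain.trans ?_
  set H : ℝ := 2 * K.bound * (k + 1) with hH
  have hH0 : 0 ≤ H := by positivity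
  have hD1 : √(∫ z, D z ^ 2) ≤ 2 * k * H / σ * (√n)⁻¹ := by
    rw [Real.sqrt_le_left (by positivity)]
    simp only [hD, mul_pow, integral_const_mul]
    have h1 := K.integral_sq_sum_rem_le (n := n) Finset.univ
    rw [Finset.univ_product_univ] at h1
    have h2 := card_overlap_le (k := k) (n := n)
    calc _ ≤ c ^ 2 * (H ^ 2 * (n ^ 2 * (2 * k ^ 2 / n ^ 2 * n.choose k) ^ 2)) := by
          gcongr
          exact h1.trans (by gcongr)
      _ = (2 * k * H / σ) ^ 2 * ((√n)⁻¹) ^ 2 := by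
          rw [hc, inv_pow, mul_pow, div_pow, hss]
          field_simp
      _ = _ := by ring
  have hξ2 : ∀ i, ∫ z, ξ i z ^ 2 = (n : ℝ)⁻¹ := by
    intro i
    simp only [hξ, mul_pow, integral_const_mul]
    rw [integral_comp_eval K.bddMeas_cproj.sq.meas, hvar, inv_pow, mul_pow, hss]
    field_simp
  -- By Cauchy–Schwarz: `‖ξ i‖₂ = n^{-1/2}` and `‖D - D' i‖₂ = O(n^{-1})`, so the sum over `i` is
  -- again `O(n^{-1/2})`.
  have hD2 : ∀ i, ∫ z, |ξ i z| * |D z - D' i z| ≤ 2 * k * H / σ * (√n)⁻¹ * (n : ℝ)⁻¹ := by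
    intro i
    refine ((hstd.bddMeas i).integral_abs_mul_abs_le (hDb.sub (hDb' i)) _).trans ?_
    rw [hξ2, ← Real.sqrt_mul (by positivity), Real.sqrt_le_left (by positivity)]
    have e : ∀ z, D z - D' i z = c * ∑ α ∈ Finset.univ.filter fun α : Fin k ↪o Fin n => i ∈ Set.range α, K.rem α z := by
      intro z
      simp only [hD, hD']
      rw [← mul_sub, ← Finset.sum_filter_add_sum_filter_not Finset.univ
        (fun α : Fin k ↪o Fin n => i ∈ Set.range α)]
      ring
    simp only [e, mul_pow c, integral_const_mul]
    have h1 := K.integral_sq_sum_rem_le (n := n) (Finset.univ.filter fun α => i ∈ Set.range α)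
    have h2 := card_overlap_mem_le (k := k) i
    have h3 : (((Finset.univ.filter fun α : Fin k ↪o Fin n => i ∈ Set.range α) ×ˢ
        (Finset.univ.filter fun α : Fin k ↪o Fin n => i ∈ Set.range α)).filter
          fun p => Overlap p.1 p.2) = Finset.univ.filter fun p : (Fin k ↪o Fin n) × (Fin k ↪o Fin n) =>
      i ∈ Set.range p.1 ∧ i ∈ Set.range p.2 ∧ Overlap p.1 p.2 := by
      ext p
      simp only [Finset.mem_filter, Finset.mem_product, Finset.mem_univ, true_and, and_assoc]
    rw [h3] at h1
    calc _ ≤ (n : ℝ)⁻¹ * (c ^ 2 * (H ^ 2 * (n * (2 * k ^ 2 / n ^ 2 * n.choose k) ^ 2))) := by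
          gcongr
          exact h1.trans (by gcongr)
      _ = (2 * k * H / σ) ^ 2 * ((√n)⁻¹) ^ 2 * (n : ℝ)⁻¹ ^ 2 := by
          rw [hc, inv_pow, mul_pow, div_pow, hss]
          field_simp
      _ = _ := by ring
  have hD3 : ∑ i, ∫ z, |ξ i z| * |D z - D' i z| ≤ 2 * k * H / σ * (√n)⁻¹ := by
    refine (Finset.sum_le_sum fun i _ => hD2 i).trans (le_of_eq ?_)
    rw [Finset.sum_const, Finset.card_univ, Fintype.card_fin, nsmul_eq_mul]
    field_simp
  -- Here `48` is `24` times the `2` in the bound of the summands, and each of the two remainder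
  -- terms contributes `4 * k * (k + 1)`.
  refine (add_le_add (add_le_add le_rfl hD1) hD3).trans (le_of_eq ?_)
  rw [hH, mul_inv]
  field_simp
  ring

end SymmKernel

/-! ### Relabelling of vertices and symmetry of the polynomials. -/

section PairPerm

variable {k : ℕ}

/-- The action of a permutation of the vertices on pairs `i < j`. -/
def pairPerm (π : Equiv.Perm (Fin k)) (p : Pairs k) : Pairs k :=
  if h : π p.1.1 < π p.1.2 then ⟨(π p.1.1, π p.1.2), h⟩
  else ⟨(π p.1.2, π p.1.1),
    lt_of_le_of_ne (not_lt.1 h) fun e => p.2.ne (π.injective e).symm⟩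

lemma pairPerm_cases (π : Equiv.Perm (Fin k)) (p : Pairs k) :
    ((pairPerm π p).1.1 = π p.1.1 ∧ (pairPerm π p).1.2 = π p.1.2) ∨
      ((pairPerm π p).1.1 = π p.1.2 ∧ (pairPerm π p).1.2 = π p.1.1) := by
  unfold pairPerm
  split_ifs <;> simp

lemma pairPerm_injective (π : Equiv.Perm (Fin k)) : Function.Injective (pairPerm π) := by
  intro p q h
  have hp := p.2
  have hq := q.2
  rcases pairPerm_cases π p with ⟨h1, h2⟩ | ⟨h1, h2⟩ <;>
    rcases pairPerm_cases π q with ⟨h3, h4⟩ | ⟨h3, h4⟩ <;>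
    rw [h] at h1 h2 <;> have e1 := π.injective (h1.symm.trans h3) <;>
    have e2 := π.injective (h2.symm.trans h4)
  · exact Subtype.ext (Prod.ext e1 e2)
  · rw [e1, e2] at hp; exact (lt_asymm hp hq).elim
  · rw [e1, e2] at hp; exact (lt_asymm hp hq).elim
  · exact Subtype.ext (Prod.ext e2 e1)

lemma pairPerm_bijective (π : Equiv.Perm (Fin k)) : Function.Bijective (pairPerm π) :=
  Finite.injective_iff_bijective.1 (pairPerm_injective π)

end PairPerm

section Polynomial

variable {k : ℕ}

open Classical in
/-- The polynomial `∑_{H ≅ F} ∏_{(i,j) ∈ E(H)} x_{i,j} ∏_{(i,j) ∉ E(H)} u (x_{i,j})`. -/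
noncomputable def phiGen (u : ℝ → ℝ) (F : SimpleGraph (Fin k)) (x : Pairs k → ℝ) : ℝ :=
  ∑ H : SimpleGraph (Fin k) with Nonempty (H ≃g F),
    ∏ p : Pairs k, if H.Adj p.1.1 p.1.2 then x p else u (x p)

lemma phiInj_eq (F : SimpleGraph (Fin k)) : phiInj F = phiGen (fun _ => 1) F := by
  funext x
  simp only [phiInj, phiGen, Finset.prod_filter]

lemma phiInd_eq (F : SimpleGraph (Fin k)) : phiInd F = phiGen (fun t => 1 - t) F := by
  funext x
  simp only [phiInd, phiGen, Finset.prod_ite]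

lemma measurable_phiGen {u : ℝ → ℝ} (hu : Measurable u) (F : SimpleGraph (Fin k)) :
    Measurable (phiGen u F) := by
  unfold phiGen
  refine Finset.measurable_sum _ fun H _ => Finset.measurable_prod _ fun p _ => ?_
  split_ifs
  · exact measurable_pi_apply p
  · exact hu.comp (measurable_pi_apply p)

open Classical in
lemma abs_phiGen_le {u : ℝ → ℝ} (hu : ∀ t, t = 0 ∨ t = 1 → |u t| ≤ 1) (F : SimpleGraph (Fin k))
    {x : Pairs k → ℝ} (hx : ∀ p, x p = 0 ∨ x p = 1) :
    |phiGen u F x| ≤ Fintype.card (SimpleGraph (Fin k)) := by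
  refine (Finset.abs_sum_le_sum_abs _ _).trans ?_
  refine (Finset.sum_le_card_nsmul _ _ 1 fun H _ => ?_).trans ?_
  · rw [Finset.abs_prod]
    refine Finset.prod_le_one (fun p _ => abs_nonneg _) fun p _ => ?_
    split_ifs
    · rcases hx p with h | h <;> simp [h]
    · exact hu _ (hx p)
  · rw [nsmul_eq_mul, mul_one]
    exact_mod_cast Finset.card_le_univ _

/-- Pulling `H` back along `π` permutes the graphs isomorphic to `F`, so it merely reindexes the
sum. -/
lemma phiGen_pairPerm (u : ℝ → ℝ) (F : SimpleGraph (Fin k)) (π : Equiv.Perm (Fin k))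
    (x : Pairs k → ℝ) : phiGen u F (fun p => x (pairPerm π p)) = phiGen u F x := by
  classical
  unfold phiGen
  symm
  refine Finset.sum_bij' (fun H _ => H.comap π) (fun H _ => H.comap π.symm) ?_ ?_ ?_ ?_ ?_
  · intro H hH
    obtain ⟨e⟩ := (Finset.mem_filter.1 hH).2
    exact Finset.mem_filter.2 ⟨Finset.mem_univ _, ⟨(SimpleGraph.Iso.comap π H).trans e⟩⟩
  · intro H hH
    obtain ⟨e⟩ := (Finset.mem_filter.1 hH).2
    exact Finset.mem_filter.2 ⟨Finset.mem_univ _, ⟨(SimpleGraph.Iso.comap π.symm H).trans e⟩⟩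
  · intro H _
    ext a b
    simp
  · intro H _
    ext a b
    simp
  · intro H _
    rw [← (pairPerm_bijective π).prod_comp]
    refine Finset.prod_congr rfl fun p _ => ?_
    refine if_congr ?_ rfl rfl
    rcases pairPerm_cases π p with ⟨h1, h2⟩ | ⟨h1, h2⟩
    · rw [h1, h2]; rfl
    · rw [h1, h2, SimpleGraph.adj_comm]; rfl

end Polynomial

/-! ### Reduction to Borel measurable graphons. -/

section Borel

variable {ι : Type*} [Fintype ι]

lemma measurePreserving_eval_pair {i j : ι} (hij : i ≠ j) :
    MeasurePreserving (fun z : ι → unitInterval => (z i, z j)) volume volume := by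
  refine ⟨(measurable_pi_apply i).prodMk (measurable_pi_apply j), ?_⟩
  have h : IndepFun (fun z : ι → unitInterval => z i) (fun z => z j) volume :=
    indepFun_of_dependsOn (S := {i}) (T := {j}) (measurable_pi_apply i) (measurable_pi_apply j)
      (fun _ _ h => h _ rfl) (fun _ _ h => h _ rfl) (by simpa using hij)
  have e : ∀ v, Measure.map (fun z : ι → unitInterval => z v) volume = volume := fun v =>
    (measurePreserving_eval (fun _ : ι => (volume : Measure unitInterval)) v).map_eq
  rw [(indepFun_iff_map_prod_eq_prod_map_map (measurable_pi_apply i).aemeasurable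
    (measurable_pi_apply j).aemeasurable).1 h, e, e]
  rfl

/-- Every graphon agrees almost everywhere with a Borel measurable one. -/
lemma Graphon.exists_measurable (κ : Graphon) : ∃ κ' : Graphon,
    Measurable (fun q : unitInterval × unitInterval => κ'.toFun q.1 q.2) ∧
      ∀ᵐ q : unitInterval × unitInterval, κ.toFun q.1 q.2 = κ'.toFun q.1 q.2 := by
  have hae := κ.nullMeasurable.aemeasurable
  set g := hae.mk with hg
  have hgm : Measurable g := hae.measurable_mk
  have hm : Measurable fun q : unitInterval × unitInterval => max (g (q.1, q.2)) (g (q.2, q.1)) :=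
    (hgm.comp (measurable_fst.prodMk measurable_snd)).max
      (hgm.comp (measurable_snd.prodMk measurable_fst))
  -- A measurable representative need not be symmetric; the maximum restores exact symmetry and
  -- changes nothing where the representative agrees with `κ` at both `q` and its swap.
  refine ⟨⟨fun x y => max (g (x, y)) (g (y, x)), fun x y => max_comm _ _, hm.nullMeasurable⟩,
    hm, ?_⟩
  have h1 := hae.ae_eq_mk
  have h2 := (Measure.measurePreserving_swap (μ := (volume : Measure unitInterval))
    (ν := (volume : Measure unitInterval))).quasiMeasurePreserving.ae h1
  filter_upwards [h1, h2] with q hq1 hq2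
  have e2 : κ.toFun q.2 q.1 = g (q.2, q.1) := hq2
  have e1 : κ.toFun q.1 q.2 = g (q.1, q.2) := hq1
  change _ = max (g (q.1, q.2)) (g (q.2, q.1))
  rw [← e1, ← e2, κ.symm q.2 q.1, max_self]

/-- For `i ≠ j` the pair `(z i, z j)` is uniform on the square. The diagonal is a null set on which
the graphons may differ, but edges never use it. -/
lemma ae_toFun_eq {κ κ' : Graphon}
    (h : ∀ᵐ q : unitInterval × unitInterval, κ.toFun q.1 q.2 = κ'.toFun q.1 q.2) :
    ∀ᵐ z : ι → unitInterval, ∀ i j, i ≠ j → κ.toFun (z i) (z j) = κ'.toFun (z i) (z j) := by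
  rw [ae_all_iff]
  intro i
  rw [ae_all_iff]
  intro j
  by_cases hij : i = j
  · exact ae_of_all _ fun z hne => (hne hij).elim
  · filter_upwards [(measurePreserving_eval_pair hij).quasiMeasurePreserving.ae h] with z hz _
    exact hz

lemma edgeInd_congr {n : ℕ} {κ κ' : Graphon} {x : Fin n → unitInterval}
    (h : ∀ i j, i ≠ j → κ.toFun (x i) (x j) = κ'.toFun (x i) (x j)) (y : Pairs n → unitInterval) :
    edgeInd κ x y = edgeInd κ' x y := by
  funext p
  simp only [edgeInd, h _ _ p.2.ne]

lemma condFirst_ae_eq {k : ℕ} [NeZero k] {κ κ' : Graphon}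
    (h : ∀ᵐ q : unitInterval × unitInterval, κ.toFun q.1 q.2 = κ'.toFun q.1 q.2)
    (φ : (Pairs k → ℝ) → ℝ) :
    condFirst (fun x y => φ (edgeInd κ x y)) =ᵐ[volume]
      condFirst (fun x y => φ (edgeInd κ' x y)) := by
  have h1 := (measurePreserving_update (0 : Fin k)).quasiMeasurePreserving.ae (ae_toFun_eq h)
  filter_upwards [Measure.ae_ae_of_ae_prod h1] with t ht
  refine integral_congr_ae ?_
  filter_upwards [ht] with x hx
  simp only [edgeInd_congr hx]

lemma centeredL2_congr {g h : unitInterval → ℝ} (hgh : g =ᵐ[volume] h) :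
    centeredL2 g = centeredL2 h := by
  unfold centeredL2
  rw [integral_congr_ae hgh]
  congr 1
  refine integral_congr_ae ?_
  filter_upwards [hgh] with t ht
  rw [ht]

end Borel

/-! ### The subgraph-count kernel. -/

section GraphKernel

variable {k n : ℕ}

lemma measurable_edgeInd {κ : Graphon}
    (hκ : Measurable (fun q : unitInterval × unitInterval => κ.toFun q.1 q.2)) :
    Measurable fun z : Fin n ⊕ Pairs n → unitInterval =>
      edgeInd κ (fun i => z (Sum.inl i)) (fun p => z (Sum.inr p)) := by
  refine measurable_pi_lambda _ fun p => ?_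
  refine Measurable.ite (measurableSet_le (measurable_pi_apply _) ?_) measurable_const
    measurable_const
  have h : Measurable fun z : Fin n ⊕ Pairs n → unitInterval =>
      (z (Sum.inl p.1.1), z (Sum.inl p.1.2)) :=
    (measurable_pi_apply _).prodMk (measurable_pi_apply _)
  exact hκ.comp h

lemma edgeInd_zero_or_one (κ : Graphon) (x : Fin n → unitInterval) (y : Pairs n → unitInterval)
    (p : Pairs n) : edgeInd κ x y p = 0 ∨ edgeInd κ x y p = 1 := by
  unfold edgeInd
  split_ifs <;> simp

/-- The kernel `φ(ξ_{i,j})` as a function of the variables `X_i`, `Y_{i,j}`. -/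
noncomputable def graphKernelFun (κ : Graphon) (u : ℝ → ℝ) (F : SimpleGraph (Fin k))
    (z : Fin k ⊕ Pairs k → unitInterval) : ℝ :=
  phiGen u F (edgeInd κ (fun i => z (Sum.inl i)) (fun p => z (Sum.inr p)))

/-- Relabelling may reverse the order of a pair; symmetry of `κ` makes the edge indicator
insensitive to this. -/
lemma graphKernelFun_perm (κ : Graphon) (u : ℝ → ℝ) (F : SimpleGraph (Fin k))
    (π : Equiv.Perm (Fin k)) (z : Fin k ⊕ Pairs k → unitInterval) :
    graphKernelFun κ u F (fun v => z (Sum.map π (pairPerm π) v)) = graphKernelFun κ u F z := by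
  unfold graphKernelFun
  rw [← phiGen_pairPerm u F π (edgeInd κ (fun i => z (Sum.inl i)) (fun p => z (Sum.inr p)))]
  congr 1
  funext p
  unfold edgeInd
  refine if_congr (iff_of_eq (congrArg₂ (· ≤ ·) rfl ?_)) rfl rfl
  simp only [Sum.map_inl]
  rcases pairPerm_cases π p with ⟨h1, h2⟩ | ⟨h1, h2⟩
  · rw [h1, h2]
  · rw [h1, h2]
    exact κ.symm _ _

/-- The kernel of the count of `F` in the random graph of a Borel measurable graphon. -/
noncomputable def graphKernel [NeZero k] (κ : Graphon)
    (hκ : Measurable (fun q : unitInterval × unitInterval => κ.toFun q.1 q.2)) {u : ℝ → ℝ}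
    (hum : Measurable u) (hu : ∀ t, t = 0 ∨ t = 1 → |u t| ≤ 1) (F : SimpleGraph (Fin k)) :
    SymmKernel k where
  f := graphKernelFun κ u F
  proj t := ∫ z, graphKernelFun κ u F (Function.update z (Sum.inl 0) t)
  bound := Fintype.card (SimpleGraph (Fin k))
  meas := (measurable_phiGen hum F).comp (measurable_edgeInd hκ)
  abs_le z := by
    have h := abs_phiGen_le hu F
      (edgeInd_zero_or_one κ (fun i => z (Sum.inl i)) (fun p => z (Sum.inr p)))
    rw [graphKernelFun]
    convert h
  proj_eq j t := by
    have hm : Measurable (graphKernelFun κ u F) :=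
      (measurable_phiGen hum F).comp (measurable_edgeInd hκ)
    -- Exchanging the vertices `0` and `j` preserves both the kernel and the measure, and turns
    -- freezing `X_j` into freezing `X_0`.
    set π := Equiv.swap 0 j with hπ
    have hinj : Function.Injective (Sum.map π (pairPerm π)) :=
      π.injective.sumMap (pairPerm_injective π)
    have hmp := measurePreserving_comp_of_injective hinj
    have e : ∀ z : Fin k ⊕ Pairs k → unitInterval,
        graphKernelFun κ u F (Function.update z (Sum.inl j) t) = graphKernelFun κ u F
          (Function.update (fun v => z (Sum.map π (pairPerm π) v)) (Sum.inl 0) t) := by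
      intro z
      rw [← graphKernelFun_perm κ u F π]
      congr 1
      have h0 : (Sum.inl j : Fin k ⊕ Pairs k) = Sum.map π (pairPerm π) (Sum.inl 0) := by
        simp [hπ]
      rw [h0]
      exact Function.update_comp_eq_of_injective' z hinj (Sum.inl 0) t
    simp only [e]
    conv_rhs => rw [← hmp.map_eq]
    exact (integral_map (f := fun z => graphKernelFun κ u F (Function.update z (Sum.inl 0) t))
      hmp.measurable.aemeasurable
      (hm.comp (measurable_update_right _ t)).aestronglyMeasurable).symm

lemma condFirst_eq_proj [NeZero k] (κ : Graphon)
    (hκ : Measurable (fun q : unitInterval × unitInterval => κ.toFun q.1 q.2)) {u : ℝ → ℝ}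
    (hum : Measurable u) (hu : ∀ t, t = 0 ∨ t = 1 → |u t| ≤ 1) (F : SimpleGraph (Fin k)) :
    condFirst (fun x y => phiGen u F (edgeInd κ x y)) = (graphKernel κ hκ hum hu F).proj := by
  funext t
  set K := graphKernel κ hκ hum hu F
  have hmp := volume_measurePreserving_sumPiEquivProdPi
    (fun _ : Fin k ⊕ Pairs k => unitInterval)
  have hb := K.bddMeas_f.comp (measurable_update_right (Sum.inl (0 : Fin k)) t)
  have hmp' := hmp.symm
  have e : K.proj t = ∫ z, K.f (Function.update z (Sum.inl 0) t) := rfl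
  rw [e, ← hmp'.map_eq, integral_map hmp'.measurable.aemeasurable hb.meas.aestronglyMeasurable]
  rw [Measure.volume_eq_prod, integral_prod _ ((hb.comp hmp'.measurable).integrable _)]
  refine integral_congr_ae (ae_of_all _ fun x => integral_congr_ae (ae_of_all _ fun y => ?_))
  change phiGen u F _ = phiGen u F _
  congr 2
  funext i
  by_cases hi : i = 0
  · subst hi; simp
  · have : (Sum.inl i : Fin k ⊕ Pairs k) ≠ Sum.inl 0 := by simpa using hi
    rw [Function.update_of_ne hi, Function.update_of_ne this]
    rfl

end GraphKernel

/-! ### Transfer to arbitrary probability spaces and conclusion. -/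

/-- The Berry–Esseen bound for the count `∑_α φ(ξ_{α(i),α(j)})`. -/
theorem kolmogorovDist_count_le {k : ℕ} [NeZero k] {u : ℝ → ℝ} (hum : Measurable u)
    (hu : ∀ t, t = 0 ∨ t = 1 → |u t| ≤ 1) (F : SimpleGraph (Fin k)) {σ : ℝ} (hσ : 0 < σ) :
    ∃ C : ℝ, ∀ κ : Graphon,
      centeredL2 (condFirst fun x y => phiGen u F (edgeInd κ x y)) = σ →
      ∀ (n : ℕ), k ≤ n →
      ∀ {Ω : Type*} [MeasurableSpace Ω] (μ : Measure Ω) [IsProbabilityMeasure μ]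
        (X : Fin n → Ω → unitInterval) (Y : Pairs n → Ω → unitInterval) (T : Ω → ℝ),
        IsUniformSample μ X Y →
        (∀ ω, T ω = ∑ α : Fin k ↪o Fin n, phiGen u F
          (fun p => edgeInd κ (fun i => X i ω) (fun p => Y p ω) (mapPair α p))) →
        kolmogorovDist μ (fun ω => √n / (k * σ) * (n.choose k : ℝ)⁻¹ * (T ω - ∫ ω', T ω' ∂μ))
          ≤ C * (n : ℝ) ^ (-(1 / 2) : ℝ) := by
  classical
  refine ⟨Fintype.card (SimpleGraph (Fin k)) * (48 + 8 * k * (k + 1)) / σ, ?_⟩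
  intro κ hκσ n hkn Ω _ μ _ X Y T hXY hT
  obtain ⟨κ', hκ', hae⟩ := κ.exists_measurable
  set K := graphKernel κ' hκ' hum hu F with hK
  have hvar : ∫ t, K.cproj t ^ 2 = σ ^ 2 := by
    rw [centeredL2_congr (condFirst_ae_eq hae _), condFirst_eq_proj κ' hκ' hum hu F] at hκσ
    rw [← hκσ, centeredL2, Real.sq_sqrt (integral_nonneg fun t => sq_nonneg _)]
    rfl
  set Z : Ω → Fin n ⊕ Pairs n → unitInterval := fun ω v => Sum.elim X Y v ω with hZ
  have hm : ∀ v, AEMeasurable (Sum.elim X Y v) μ := by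
    rintro (i | p)
    · exact (hXY.lawX i).aemeasurable
    · exact (hXY.lawY p).aemeasurable
  have hZm : AEMeasurable Z μ := aemeasurable_pi_lambda _ hm
  -- Joint independence and uniform marginals identify the law of the sample, so the problem moves
  -- to the product space.
  have hmap : μ.map Z = volume := by
    rw [(iIndepFun_iff_map_fun_eq_pi_map hm).1 hXY.indep, volume_pi]
    congr 1
    funext v
    rcases v with i | p
    · exact (hXY.lawX i).map_eq
    · exact (hXY.lawY p).map_eq
  have hTZ : ∀ᵐ ω ∂μ, T ω = K.ustat (Z ω) := by
    have h1 : ∀ᵐ z ∂(μ.map Z), ∀ i j, i ≠ j → κ.toFun (z i) (z j) = κ'.toFun (z i) (z j) := by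
      rw [hmap]; exact ae_toFun_eq hae
    filter_upwards [ae_of_ae_map hZm h1] with ω hω
    rw [hT]
    refine Finset.sum_congr rfl fun α _ => ?_
    rw [edgeInd_congr (κ' := κ') (x := fun i => X i ω) (fun i j hij =>
      hω (Sum.inl i) (Sum.inl j) (by simpa using hij))]
    rfl
  have hmean : ∫ ω, T ω ∂μ = n.choose k * K.mean := by
    rw [integral_congr_ae hTZ, ← K.integral_ustat, ← hmap,
      integral_map hZm K.bddMeas_ustat.meas.aestronglyMeasurable]
  have hrpow : (n : ℝ) ^ (-(1 / 2) : ℝ) = (√n)⁻¹ := by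
    rw [Real.rpow_neg (by positivity), Real.sqrt_eq_rpow]
  refine ciSup_le fun x => ?_
  rw [hrpow, hmean]
  refine le_trans (le_of_eq ?_) (K.ustat_berryEsseen hkn hσ hvar x)
  have hset : MeasurableSet {z : Fin n ⊕ Pairs n → unitInterval | √n / (k * σ) *
      (n.choose k : ℝ)⁻¹ * (K.ustat z - n.choose k * K.mean) ≤ x} :=
    measurableSet_le ((K.bddMeas_ustat.meas.sub_const _).const_mul _) measurable_const
  have hmeas : μ.real {ω | √n / (k * σ) * (n.choose k : ℝ)⁻¹ * (T ω - n.choose k * K.mean) ≤ x} =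
      (volume : Measure (Fin n ⊕ Pairs n → unitInterval)).real {z | √n / (k * σ) *
        (n.choose k : ℝ)⁻¹ * (K.ustat z - n.choose k * K.mean) ≤ x} := by
    rw [← hmap, Measure.real, Measure.real, Measure.map_apply_of_aemeasurable hZm hset]
    congr 1
    refine measure_congr ?_
    filter_upwards [hTZ] with ω hω
    refine propext ?_
    change _ ≤ x ↔ _ ≤ x
    rw [hω]
  rw [hmeas]
  rfl

end KappaGraph

/-- For every finite simple graph `F` on `k ≥ 1` vertices and every `σ > 0` there is a constant
`C`, depending only on `F` and `σ`, that works for all graphons with projection standard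
deviation `σ` and all `n ≥ k`; this is asserted for injective and for induced counts. -/
theorem theorem3p1 {k : ℕ} [NeZero k] (F : SimpleGraph (Fin k)) (σ : ℝ) (hσ : 0 < σ) :
    (∃ C : ℝ, ∀ κ : Graphon, sigmaInj κ F = σ →
      ∀ (n : ℕ), k ≤ n →
      ∀ {Ω : Type*} [MeasurableSpace Ω] (μ : Measure Ω) [IsProbabilityMeasure μ]
        (X : Fin n → Ω → unitInterval) (Y : Pairs n → Ω → unitInterval),
        IsUniformSample μ X Y →
        kolmogorovDist μ (fun ω => Real.sqrt n / (k * sigmaInj κ F) * ((n.choose k : ℝ))⁻¹ *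
            (TInj κ F X Y ω - ∫ ω', TInj κ F X Y ω' ∂μ))
          ≤ C * (n : ℝ) ^ (-(1 / 2) : ℝ)) ∧
    (∃ C : ℝ, ∀ κ : Graphon, sigmaInd κ F = σ →
      ∀ (n : ℕ), k ≤ n →
      ∀ {Ω : Type*} [MeasurableSpace Ω] (μ : Measure Ω) [IsProbabilityMeasure μ]
        (X : Fin n → Ω → unitInterval) (Y : Pairs n → Ω → unitInterval),
        IsUniformSample μ X Y →
        kolmogorovDist μ (fun ω => Real.sqrt n / (k * sigmaInd κ F) * ((n.choose k : ℝ))⁻¹ *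
            (TInd κ F X Y ω - ∫ ω', TInd κ F X Y ω' ∂μ))
          ≤ C * (n : ℝ) ^ (-(1 / 2) : ℝ)) := by
  constructor
  · obtain ⟨C, hC⟩ := kolmogorovDist_count_le (u := fun _ => 1) measurable_const
      (fun _ _ => by simp) F hσ
    refine ⟨C, fun κ hκ n hkn Ω _ μ _ X Y hXY => ?_⟩
    rw [hκ]
    refine hC κ ?_ n hkn μ X Y (TInj κ F X Y) hXY fun ω => ?_
    · rw [← hκ, sigmaInj, projInj, phiInj_eq]
    · rw [TInj, countInj, phiInj_eq]
  · obtain ⟨C, hC⟩ := kolmogorovDist_count_le (u := fun t => 1 - t) (measurable_id.const_sub 1)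
      (fun t ht => by rcases ht with rfl | rfl <;> simp) F hσ
    refine ⟨C, fun κ hκ n hkn Ω _ μ _ X Y hXY => ?_⟩
    rw [hκ]
    refine hC κ ?_ n hkn μ X Y (TInd κ F X Y) hXY fun ω => ?_
    · rw [← hκ, sigmaInd, projInd, phiInd_eq]
    · rw [TInd, countInd, phiInd_eq]
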